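/- **Model.** Let $\mathcal G$ be a connected undirected graph with finite vertex set $\{1,\dots,K\}$, and let $V_i$ consist of $i$ and all vertices adjacent to $i$. Let $A(1),A(2),\dots$ be i.i.d. random vectors in $\{0,1,2,\dots\}^K$ (the coordinates of one vector may be dependent) with $\mathbf E A_i(n)=\lambda_i\in(0,\infty)$. For $x\in\{0,1,2,\dots\}^K$ let $W^x(0)=x$ and $$W^x_i(n)=W^x_i(n-1)+A_i(n)-\mathbf 1\big(N^x_i(n-1)=1\big)\prod_{j\in V_i\setminus\{i\}}\mathbf 1\big(N^x_j(n-1)=0\big),\qquad n\ge 1,$$ where, given the arrivals up to time $n$ and the $N^x(m)$, $m<n$, the variables $N^x_1(n),\dots,N^x_K(n)$ are independent and $N^x_i(n)$ is binomial with parameters $W^x_i(n)$ and $1/\sum_{j\in V_i}W^x_j(n)$ (and $N^x_i(n)=0$ if this sum is $0$), and where $A(n+1)$ is independent of the arrivals up to time $n$ and of $N^x(0),\dots,N^x(n)$. The arrivals are the same for all $x$; the joint law of the systems with different $x$ is otherwise arbitrary. **Fluid limits.** Let $|x|=\sum_i|x_i|$, let $x^n\in\{0,1,2,\dots\}^K$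 with $|x^n|\to\infty$, and let $X^n(t)=W^{x^n}(\lfloor |x^n|t\rfloor)/|x^n|$, $t\ge 0$. These are random elements of the space $\mathbb D$ of càdlàg functions $[0,\infty)\to\mathbb R^K$ with the metric $d=\sum_{T=1}^\infty 2^{-T}\frac{d_T}{1+d_T}$, where $d_T(f_1,f_2)=\inf_g\sup_{0\le t\le T}\{|g(t)-t|+|f_1(g(t))-f_2(t)|\}$, the infimum being over all increasing bijections $g$ of $[0,T]$. A fluid limit is an accumulation point in $\mathbb D$ of the sequence $X^n$, where this is understood either path by path (an accumulation point of the sequence of paths $X^n(\omega)$) or in distribution (a random element $z$ of $\mathbb D$, on any probability space, to which some subsequence of $X^n$ converges in distribution). **Theorem 3.** For $x\in\mathbb R^K$ put $\phi_i(x)=x_i/\sum_{j\in V_i}x_j$. Say that a path $z\in\mathbb D$ satisfies the fluid equation if for every $t\ge 0$ such that $\sum_{j\in V_i}z_j(t)>0$ for all $i$, every coordinate $z_i$ is differentiable at $t$ (right-differentiable if $t=0$), with (right) derivative $$z_i'(t)=\lambda_i-\phi_i(z(t))\exp\Big(-\sum_{j\in V_i}\phi_j(z(t))\Big).$$ Then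 (a) almost surely, every accumulation point of the paths $X^n$ satisfies the fluid equation; and (b) if a random path $z$ is the limit in distribution of a subsequence of $X^n$, then almost surely $z$ satisfies the fluid equation. -/

import Mathlib

open MeasureTheory ProbabilityTheory Filter Topology
open scoped NNReal ENNReal

namespace SpatialAloha

/-! ### Càdlàg paths and the Skorokhod metric -/

/-- The space `𝔻([0,∞), ℝ^V)` of càdlàg paths: right-continuous with left limits. -/
structure CadlagPath (V : Type*) where
  toFun : ℝ≥0 → V → ℝ
  right_continuous : ∀ t, ContinuousWithinAt toFun (Set.Ici t) t
  left_limit : ∀ t, ∃ l, Tendsto toFun (𝓝[<] t) (𝓝 l)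

instance {V : Type*} : CoeFun (CadlagPath V) (fun _ => ℝ≥0 → V → ℝ) := ⟨CadlagPath.toFun⟩

section Skorokhod

variable {V : Type*} [Fintype V]

/-- The `L¹`-metric on `ℝ^V`. -/
def l1Dist (x y : V → ℝ) : ℝ := ∑ i, |x i - y i|

/-- An increasing time change of `[0,T]`; it is automatically continuous and fixes `0` and `T`. -/
abbrev TimeChange (T : ℝ≥0) := Set.Icc (0 : ℝ≥0) T ≃o Set.Icc (0 : ℝ≥0) T

/-- `sup_{t ∈ [0,T]} (|e(t) - t| + ρ(f(e(t)), g(t)))`. -/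
noncomputable def skorokhodCost (T : ℝ≥0) (f g : CadlagPath V) (e : TimeChange T) : ℝ≥0∞ :=
  ⨆ t : Set.Icc (0 : ℝ≥0) T,
    ENNReal.ofReal (dist (e t : ℝ≥0) (t : ℝ≥0) + l1Dist (f (e t : ℝ≥0)) (g (t : ℝ≥0)))

/-- The Skorokhod distance `d_T` on `[0,T]` as an extended number (always finite, see
`skorokhodEDist_ne_top`). -/
noncomputable def skorokhodEDist (T : ℝ≥0) (f g : CadlagPath V) : ℝ≥0∞ :=
  ⨅ e : TimeChange T, skorokhodCost T f g e

/-- The Skorokhod distance `d_T` on `[0,T]`. -/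
noncomputable def skorokhodDist (T : ℝ≥0) (f g : CadlagPath V) : ℝ :=
  (skorokhodEDist T f g).toReal

/-- The term of index `T + 1` of `d = ∑_{T ≥ 1} 2^{-T} d_T / (1 + d_T)`. -/
noncomputable def skorokhodTerm (f g : CadlagPath V) (T : ℕ) : ℝ :=
  (1 / 2 : ℝ) ^ (T + 1) *
    (skorokhodDist ((T : ℝ≥0) + 1) f g / (1 + skorokhodDist ((T : ℝ≥0) + 1) f g))

lemma l1Dist_nonneg (x y : V → ℝ) : 0 ≤ l1Dist x y :=
  Finset.sum_nonneg fun _ _ => abs_nonneg _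

lemma l1Dist_self (x : V → ℝ) : l1Dist x x = 0 := by simp [l1Dist]

lemma l1Dist_comm (x y : V → ℝ) : l1Dist x y = l1Dist y x := by
  simp only [l1Dist, abs_sub_comm]

lemma l1Dist_triangle (x y z : V → ℝ) : l1Dist x z ≤ l1Dist x y + l1Dist y z := by
  unfold l1Dist
  rw [← Finset.sum_add_distrib]
  exact Finset.sum_le_sum fun i _ => abs_sub_le _ _ _

/-- A càdlàg path is bounded on `[0,T]`. -/
lemma CadlagPath.bounded (f : CadlagPath V) (T : ℝ≥0) :
    ∃ C : ℝ, ∀ t ∈ Set.Icc (0 : ℝ≥0) T, l1Dist (f t) 0 ≤ C := by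
  have hcont : Continuous fun x : V → ℝ => l1Dist x 0 := by
    unfold l1Dist
    fun_prop
  refine IsCompact.induction_on (p := fun s => ∃ C : ℝ, ∀ t ∈ s, l1Dist (f t) 0 ≤ C)
    (isCompact_Icc (a := (0 : ℝ≥0)) (b := T)) ⟨0, by simp⟩ ?_ ?_ ?_
  · rintro s t hst ⟨C, hC⟩
    exact ⟨C, fun u hu => hC u (hst hu)⟩
  · rintro s t ⟨C, hC⟩ ⟨C', hC'⟩
    refine ⟨max C C', ?_⟩
    rintro u (hu | hu)
    · exact (hC u hu).trans (le_max_left _ _)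
    · exact (hC' u hu).trans (le_max_right _ _)
  · intro t _
    obtain ⟨l, hl⟩ := f.left_limit t
    have h1 : ∀ᶠ u in 𝓝[≥] t, l1Dist (f u) 0 ≤ l1Dist (f t) 0 + 1 :=
      (((hcont.tendsto _).comp (f.right_continuous t)).eventually
        (eventually_lt_nhds (lt_add_one _))).mono fun _ h => le_of_lt h
    have h2 : ∀ᶠ u in 𝓝[<] t, l1Dist (f u) 0 ≤ l1Dist l 0 + 1 :=
      (((hcont.tendsto _).comp hl).eventually
        (eventually_lt_nhds (lt_add_one _))).mono fun _ h => le_of_lt h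
    have h3 : ∀ᶠ u in 𝓝 t,
        l1Dist (f u) 0 ≤ max (l1Dist (f t) 0 + 1) (l1Dist l 0 + 1) := by
      rw [← nhdsLT_sup_nhdsGE, eventually_sup]
      exact ⟨h2.mono fun _ h => h.trans (le_max_right _ _),
        h1.mono fun _ h => h.trans (le_max_left _ _)⟩
    exact ⟨_, mem_nhdsWithin_of_mem_nhds h3, _, fun u hu => hu⟩

lemma skorokhodEDist_ne_top (T : ℝ≥0) (f g : CadlagPath V) : skorokhodEDist T f g ≠ ∞ := by
  obtain ⟨C, hC⟩ := f.bounded T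
  obtain ⟨D, hD⟩ := g.bounded T
  refine ne_top_of_le_ne_top (ENNReal.ofReal_ne_top (r := C + D)) ?_
  refine (iInf_le _ (OrderIso.refl _)).trans (iSup_le fun t => ENNReal.ofReal_le_ofReal ?_)
  have h := l1Dist_triangle (f (t : ℝ≥0)) 0 (g (t : ℝ≥0))
  rw [l1Dist_comm 0] at h
  simpa using h.trans (add_le_add (hC _ t.2) (hD _ t.2))

lemma skorokhodEDist_self (T : ℝ≥0) (f : CadlagPath V) : skorokhodEDist T f f = 0 := by
  refine le_antisymm ((iInf_le _ (OrderIso.refl _)).trans (iSup_le fun t => ?_)) zero_le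
  simp [l1Dist_self]

lemma skorokhodEDist_comm_le (T : ℝ≥0) (f g : CadlagPath V) :
    skorokhodEDist T g f ≤ skorokhodEDist T f g := by
  refine le_iInf fun e => (iInf_le _ e.symm).trans (iSup_le fun t => ?_)
  refine le_trans (le_of_eq ?_) (le_iSup _ (e.symm t))
  rw [e.apply_symm_apply, dist_comm, l1Dist_comm]

lemma skorokhodEDist_triangle (T : ℝ≥0) (f g h : CadlagPath V) :
    skorokhodEDist T f h ≤ skorokhodEDist T f g + skorokhodEDist T g h := by
  unfold skorokhodEDist
  rw [ENNReal.iInf_add]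
  refine le_iInf fun e₁ => ?_
  rw [ENNReal.add_iInf]
  refine le_iInf fun e₂ => (iInf_le _ (e₂.trans e₁)).trans (iSup_le fun t => ?_)
  refine le_trans ?_ (add_le_add (le_iSup _ (e₂ t)) (le_iSup _ t))
  rw [← ENNReal.ofReal_add (add_nonneg dist_nonneg (l1Dist_nonneg _ _))
    (add_nonneg dist_nonneg (l1Dist_nonneg _ _))]
  refine ENNReal.ofReal_le_ofReal ?_
  rw [OrderIso.trans_apply]
  have h1 := dist_triangle (e₁ (e₂ t) : ℝ≥0) (e₂ t : ℝ≥0) (t : ℝ≥0)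
  have h2 := l1Dist_triangle (f (e₁ (e₂ t) : ℝ≥0)) (g (e₂ t : ℝ≥0)) (h (t : ℝ≥0))
  linarith

lemma skorokhodDist_nonneg (T : ℝ≥0) (f g : CadlagPath V) : 0 ≤ skorokhodDist T f g :=
  ENNReal.toReal_nonneg

lemma skorokhodDist_triangle (T : ℝ≥0) (f g h : CadlagPath V) :
    skorokhodDist T f h ≤ skorokhodDist T f g + skorokhodDist T g h := by
  unfold skorokhodDist
  rw [← ENNReal.toReal_add (skorokhodEDist_ne_top _ _ _) (skorokhodEDist_ne_top _ _ _)]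
  exact ENNReal.toReal_mono
    (ENNReal.add_ne_top.2 ⟨skorokhodEDist_ne_top _ _ _, skorokhodEDist_ne_top _ _ _⟩)
    (skorokhodEDist_triangle T f g h)

lemma skorokhodTerm_nonneg (f g : CadlagPath V) (T : ℕ) : 0 ≤ skorokhodTerm f g T := by
  have := skorokhodDist_nonneg ((T : ℝ≥0) + 1) f g
  unfold skorokhodTerm
  positivity

lemma skorokhodTerm_summable (f g : CadlagPath V) : Summable (skorokhodTerm f g) := by
  refine Summable.of_nonneg_of_le (skorokhodTerm_nonneg f g) (fun T => ?_)
    ((summable_nat_add_iff 1).2 summable_geometric_two)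
  have := skorokhodDist_nonneg ((T : ℝ≥0) + 1) f g
  refine mul_le_of_le_one_right (by positivity) ?_
  rw [div_le_one (by positivity)]
  linarith

/-- The Skorokhod space `𝔻([0,∞), ℝ^V)`, with `d = ∑_{T ≥ 1} 2^{-T} d_T / (1 + d_T)`. -/
noncomputable instance : PseudoMetricSpace (CadlagPath V) where
  dist f g := ∑' T, skorokhodTerm f g T
  dist_self f := by
    simp [skorokhodTerm, skorokhodDist, skorokhodEDist_self]
  dist_comm f g := by
    simp only [skorokhodTerm, skorokhodDist,
      le_antisymm (skorokhodEDist_comm_le _ f g) (skorokhodEDist_comm_le _ g f)]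
  dist_triangle f g h := by
    rw [← (skorokhodTerm_summable f g).tsum_add (skorokhodTerm_summable g h)]
    refine (skorokhodTerm_summable f h).tsum_le_tsum (fun T => ?_)
      ((skorokhodTerm_summable f g).add (skorokhodTerm_summable g h))
    have ha := skorokhodDist_nonneg ((T : ℝ≥0) + 1) f h
    have hb := skorokhodDist_nonneg ((T : ℝ≥0) + 1) f g
    have hc := skorokhodDist_nonneg ((T : ℝ≥0) + 1) g h
    have habc := skorokhodDist_triangle ((T : ℝ≥0) + 1) f g h
    unfold skorokhodTerm
    rw [← mul_add]
    refine mul_le_mul_of_nonneg_left ?_ (by positivity)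
    generalize skorokhodDist ((T : ℝ≥0) + 1) f h = a at *
    generalize skorokhodDist ((T : ℝ≥0) + 1) f g = b at *
    generalize skorokhodDist ((T : ℝ≥0) + 1) g h = c at *
    calc a / (1 + a) ≤ (b + c) / (1 + (b + c)) := by
          rw [div_le_div_iff₀ (by positivity) (by positivity)]
          nlinarith
      _ = b / (1 + (b + c)) + c / (1 + (b + c)) := add_div _ _ _
      _ ≤ b / (1 + b) + c / (1 + c) := by
          gcongr <;> linarith

/-- The Borel `σ`-algebra of the Skorokhod space. -/
noncomputable instance : MeasurableSpace (CadlagPath V) := borel _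

instance : BorelSpace (CadlagPath V) := ⟨rfl⟩

end Skorokhod

/-! ### The service system on a graph -/

section Model

variable {V : Type*} [Fintype V] [DecidableEq V] (G : SimpleGraph V) [DecidableRel G.Adj]

/-- The neighbourhood `V_i`: the vertex `i` and all vertices adjacent to it. -/
def nbhd (i : V) : Finset V := insert i (G.neighborFinset i)

variable {Ω : Type*}

/-- The numbers of users `W^x(n)`, driven by the arrivals (`A n` at time `n + 1`) and by the
numbers of attempted transmissions (`N n` at time `n`). At time `n` one user of vertex `i` leaves if exactly one user
attempts at `i` and nobody attempts at the other vertices of `V_i`. (Almost surely `N n i ≤ W n i`,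
so that the subtraction does not truncate.) -/
def workload (A N : ℕ → Ω → V → ℕ) (x : V → ℕ) : ℕ → Ω → V → ℕ
  | 0 => fun _ => x
  | n + 1 => fun ω i => workload A N x n ω i + A n ω i -
      (if N n ω i = 1 ∧ ∀ j ∈ (nbhd G i).erase i, N n ω j = 0 then 1 else 0)

/-- The weight at `k` of the binomial distribution with parameters `m` and `p`. -/
noncomputable def binomialWeight (m : ℕ) (p : ℝ) (k : ℕ) : ℝ :=
  (m.choose k : ℝ) * p ^ k * (1 - p) ^ (m - k)

/-- The history up to time `n`: the arrivals at times `1, …, n` and the attempts at times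
`0, …, n - 1`. -/
abbrev history (A N : ℕ → Ω → V → ℕ) (n : ℕ) : MeasurableSpace Ω :=
  (⨆ m < n, MeasurableSpace.comap (A m) inferInstance) ⊔
    (⨆ m < n, MeasurableSpace.comap (N m) inferInstance)

/-- The stochastic model. `A n` is the vector of arrivals at time `n + 1`, common to all initial
conditions; `N x n` is the vector of numbers of users attempting transmission at time `n` in the
system with initial condition `x`. The joint law of the systems with different initial conditions
is not restricted any further. -/
structure IsModel [MeasurableSpace Ω] (μ : Measure Ω) (lam : V → ℝ)
    (A : ℕ → Ω → V → ℕ) (N : (V → ℕ) → ℕ → Ω → V → ℕ) : Prop where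
  measurable_arrivals : ∀ n, Measurable (A n)
  measurable_attempts : ∀ x n, Measurable (N x n)
  arrivals_indep : iIndepFun A μ
  arrivals_identDistrib : ∀ n, IdentDistrib (A n) (A 0) μ μ
  arrivals_integrable : ∀ n i, Integrable (fun ω => (A n ω i : ℝ)) μ
  arrivals_mean : ∀ n i, ∫ ω, (A n ω i : ℝ) ∂μ = lam i
  mean_pos : ∀ i, 0 < lam i
  /-- Given the history, the `N_i(n)` are independent and binomial with parameters `W_i(n)` and
  `1 / ∑_{j ∈ V_i} W_j(n)`. -/
  attempts_law : ∀ (x : V → ℕ) (n : ℕ) (k : V → ℕ),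
    μ⟦{ω | N x n ω = k} | history A (N x) n⟧ =ᵐ[μ] fun ω =>
      ∏ i, binomialWeight (workload G A (N x) x n ω i)
        (1 / ∑ j ∈ nbhd G i, (workload G A (N x) x n ω j : ℝ)) (k i)
  /-- New arrivals are independent of the past. -/
  arrivals_indep_past : ∀ (x : V → ℕ) (n : ℕ),
    Indep (MeasurableSpace.comap (A n) inferInstance)
      (history A (N x) n ⊔ MeasurableSpace.comap (N x n) inferInstance) μ

/-! ### Scaled processes and fluid limits -/

lemma eventually_floor_mul_right (m : ℕ) (t : ℝ≥0) :
    ∀ᶠ u in 𝓝[≥] t, ⌊(m : ℝ≥0) * u⌋₊ = ⌊(m : ℝ≥0) * t⌋₊ := by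
  have hc : Continuous fun u : ℝ≥0 => (m : ℝ≥0) * u := by fun_prop
  filter_upwards [mem_nhdsWithin_of_mem_nhds
    (hc.continuousAt.eventually (eventually_lt_nhds (Nat.lt_floor_add_one ((m : ℝ≥0) * t)))),
    self_mem_nhdsWithin] with u hu htu
  rw [Nat.floor_eq_iff zero_le]
  exact ⟨(Nat.floor_le zero_le).trans (mul_le_mul_right htu _), hu⟩

lemma exists_eventually_floor_mul_left (m : ℕ) (t : ℝ≥0) :
    ∃ k : ℕ, ∀ᶠ u in 𝓝[<] t, ⌊(m : ℝ≥0) * u⌋₊ = k := by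
  rcases Nat.eq_zero_or_pos m with rfl | hm
  · exact ⟨0, by simp⟩
  rcases eq_or_lt_of_le (zero_le (a := t)) with rfl | ht
  · exact ⟨0, by simp⟩
  have hm' : (0 : ℝ≥0) < m := by exact_mod_cast hm
  have hc : Continuous fun u : ℝ≥0 => (m : ℝ≥0) * u := by fun_prop
  obtain ⟨k, hk⟩ : ∃ k : ℕ, ⌈(m : ℝ≥0) * t⌉₊ = k + 1 :=
    Nat.exists_eq_succ_of_ne_zero (Nat.ceil_pos.2 (mul_pos hm' ht)).ne'
  have hkt : (k : ℝ≥0) < m * t := Nat.lt_ceil.1 (by omega)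
  have htk : (m : ℝ≥0) * t ≤ (k : ℝ≥0) + 1 := by
    have := Nat.le_ceil ((m : ℝ≥0) * t)
    rw [hk] at this
    exact_mod_cast this
  refine ⟨k, ?_⟩
  filter_upwards [mem_nhdsWithin_of_mem_nhds
    (hc.continuousAt.eventually (eventually_gt_nhds hkt)), self_mem_nhdsWithin] with u hu hut
  rw [Nat.floor_eq_iff zero_le]
  exact ⟨hu.le, (mul_lt_mul_of_pos_left hut hm').trans_le htk⟩

/-- A sequence run at speed `m` and divided by `m`: the path `t ↦ w(⌊m t⌋) / m`. -/
noncomputable def scaledPath (m : ℕ) (w : ℕ → V → ℕ) : CadlagPath V where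
  toFun t i := (w ⌊(m : ℝ≥0) * t⌋₊ i : ℝ) / m
  right_continuous t := by
    refine tendsto_const_nhds.congr' ?_
    filter_upwards [eventually_floor_mul_right m t] with u hu
    rw [hu]
  left_limit t := by
    obtain ⟨k, hk⟩ := exists_eventually_floor_mul_left m t
    refine ⟨fun i => (w k i : ℝ) / m, tendsto_const_nhds.congr' ?_⟩
    filter_upwards [hk] with u hu
    rw [hu]

/-- The scaled process `X(t) = W^x(⌊|x| t⌋) / |x|`, where `|x| = ∑_i x_i`. -/
noncomputable def scaledProcess (A : ℕ → Ω → V → ℕ) (N : (V → ℕ) → ℕ → Ω → V → ℕ) (x : V → ℕ)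
    (ω : Ω) : CadlagPath V :=
  scaledPath (∑ i, x i) (fun n => workload G A (N x) x n ω)

/-- The path `z` is an accumulation point, in the Skorokhod space, of the paths `X n`. -/
def IsPathwiseFluidLimit (X : ℕ → CadlagPath V) (z : CadlagPath V) : Prop :=
  MapClusterPt z atTop X

/-- The random path `z` is an accumulation point in distribution, in the Skorokhod space, of the
random paths `X n`. -/
def IsFluidLimitInLaw [MeasurableSpace Ω] (μ : Measure Ω) [IsProbabilityMeasure μ]
    (X : ℕ → Ω → CadlagPath V) {Ω' : Type*} [MeasurableSpace Ω'] (ν : Measure Ω')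
    [IsProbabilityMeasure ν] (z : Ω' → CadlagPath V) : Prop :=
  ∃ s : ℕ → ℕ, StrictMono s ∧
    TendstoInDistribution (fun k => X (s k)) atTop z (fun _ => μ) ν

/-- `φ_i(x) = x_i / ∑_{j ∈ V_i} x_j`. -/
noncomputable def phi (x : V → ℝ) (i : V) : ℝ := x i / ∑ j ∈ nbhd G i, x j

/-- At every time `t` at which all neighbourhood sums of `z` are positive, each coordinate of `z`
is differentiable (from the right if `t = 0`) and
`z_i'(t) = λ_i - φ_i(z(t)) exp(-∑_{j ∈ V_i} φ_j(z(t)))`. -/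
def SatisfiesFluidEquation (lam : V → ℝ) (z : CadlagPath V) : Prop :=
  ∀ t : ℝ≥0, (∀ i, 0 < ∑ j ∈ nbhd G i, z t j) → ∀ i,
    (0 < t → HasDerivAt (fun s : ℝ => z s.toNNReal i)
      (lam i - phi G (z t) i * Real.exp (-∑ j ∈ nbhd G i, phi G (z t) j)) t) ∧
    (t = 0 → HasDerivWithinAt (fun s : ℝ => z s.toNNReal i)
      (lam i - phi G (z t) i * Real.exp (-∑ j ∈ nbhd G i, phi G (z t) j)) (Set.Ici 0) 0)

end Model

end SpatialAloha

namespace SpatialAloha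

/-! The number of users at a vertex is its initial value plus arrivals minus services, and the
services are the sum of their conditional probabilities, which depend on the current state only,
plus a martingale with increments bounded by one. Up to time `j |x|` the centred arrivals and the
martingale are both small compared with `|x|`. For the arrivals this is the strong law, used once
for all `x` since they are shared. For the martingale an exponential bound is summable over all
initial states, so Borel–Cantelli needs nothing about the joint law of the systems. Hence almost
surely, for every `j`, the scaled paths are eventually in `nearlyFluidPaths G lam j`
(`IsModel.ae_eventually_mem_nearlyFluidPaths`).

The rest of the analysis is deterministic: a path in the closure of every `nearlyFluidPaths G lam j`
solves the fluid equation (`satisfiesFluidEquation_of_mem_closure`). The approximants are Lipschitz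
up to a small error, so Skorokhod closeness becomes uniform closeness and the limit is Lipschitz.
Where the neighbourhood sums are positive, the Poisson limit of the binomial law turns the service
probability into the fluid rate (`tendsto_serviceProb`), which determines the increments to first
order.

Closed sets serve both notions of limit: a cluster point lies in the closure of any set that
eventually contains the sequence, and by the portmanteau theorem so does, almost surely, a limit in
distribution. Neither tightness nor a coupling is needed. -/

/-! ### Binomial weights. -/

lemma binomialWeight_nonneg {p : ℝ} (hp0 : 0 ≤ p) (hp1 : p ≤ 1) (m k : ℕ) :
    0 ≤ binomialWeight m p k := by
  have : 0 ≤ 1 - p := by linarith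
  unfold binomialWeight
  positivity

lemma binomialWeight_eq_zero {m k : ℕ} (h : m < k) (p : ℝ) : binomialWeight m p k = 0 := by
  simp [binomialWeight, Nat.choose_eq_zero_of_lt h]

lemma sum_binomialWeight (m : ℕ) (p : ℝ) :
    ∑ k ∈ Finset.range (m + 1), binomialWeight m p k = 1 := by
  have h := add_pow p (1 - p) m
  rw [add_sub_cancel, one_pow] at h
  rw [h]
  exact Finset.sum_congr rfl fun k _ => by unfold binomialWeight; ring

lemma binomialWeight_le_one {p : ℝ} (hp0 : 0 ≤ p) (hp1 : p ≤ 1) (m k : ℕ) :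
    binomialWeight m p k ≤ 1 := by
  rcases lt_or_ge m k with h | h
  · rw [binomialWeight_eq_zero h]; exact zero_le_one
  · rw [← sum_binomialWeight m p]
    exact Finset.single_le_sum (f := fun k => binomialWeight m p k)
      (fun k _ => binomialWeight_nonneg hp0 hp1 m k)
      (Finset.mem_range.2 (Nat.lt_succ_of_le h))

/-! ### Service probabilities given the state. -/

section

variable {V : Type*} [Fintype V] [DecidableEq V] (G : SimpleGraph V) [DecidableRel G.Adj]

/-- The transmission probability `1 / ∑_{j ∈ V_i} w_j` of a user at `i`. -/
noncomputable def attemptProb (w : V → ℕ) (i : V) : ℝ := 1 / ∑ j ∈ nbhd G i, (w j : ℝ)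

lemma attemptProb_nonneg (w : V → ℕ) (i : V) : 0 ≤ attemptProb G w i := by
  unfold attemptProb
  positivity

lemma attemptProb_le_one (w : V → ℕ) (i : V) : attemptProb G w i ≤ 1 := by
  unfold attemptProb
  rw [← Nat.cast_sum, one_div]
  exact Nat.cast_inv_le_one _

/-- The probability that a user at `i` is served, given that the numbers of users are `w`. -/
noncomputable def serviceProb (i : V) (w : V → ℕ) : ℝ :=
  binomialWeight (w i) (attemptProb G w i) 1 *
    ∏ j ∈ (nbhd G i).erase i, binomialWeight (w j) (attemptProb G w j) 0

lemma serviceProb_nonneg (i : V) (w : V → ℕ) : 0 ≤ serviceProb G i w :=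
  mul_nonneg (binomialWeight_nonneg (attemptProb_nonneg G w i) (attemptProb_le_one G w i) _ _)
    (Finset.prod_nonneg fun j _ =>
      binomialWeight_nonneg (attemptProb_nonneg G w j) (attemptProb_le_one G w j) _ _)

lemma serviceProb_le_one (i : V) (w : V → ℕ) : serviceProb G i w ≤ 1 :=
  mul_le_one₀ (binomialWeight_le_one (attemptProb_nonneg G w i) (attemptProb_le_one G w i) _ _)
    (Finset.prod_nonneg fun j _ =>
      binomialWeight_nonneg (attemptProb_nonneg G w j) (attemptProb_le_one G w j) _ _)
    (Finset.prod_le_one (fun j _ =>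
      binomialWeight_nonneg (attemptProb_nonneg G w j) (attemptProb_le_one G w j) _ _) fun j _ =>
      binomialWeight_le_one (attemptProb_nonneg G w j) (attemptProb_le_one G w j) _ _)

lemma serviceProb_eq_zero {i : V} {w : V → ℕ} (h : w i = 0) : serviceProb G i w = 0 := by
  simp [serviceProb, h, binomialWeight_eq_zero]

/-! ### The fluid limit of the service probability -/

/-- This is `1 + y ≤ exp y` at `y = p / (1 - p)`, where `1 + y = 1 / (1 - p)`. -/
lemma exp_neg_div_one_sub_le {p : ℝ} (hp : p < 1) : Real.exp (-(p / (1 - p))) ≤ 1 - p := by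
  have h : 0 < 1 - p := by linarith
  rw [Real.exp_neg, inv_le_comm₀ (Real.exp_pos _) h]
  have h1 := Real.add_one_le_exp (p / (1 - p))
  have h2 : (1 - p)⁻¹ = p / (1 - p) + 1 := by field_simp; ring
  rwa [h2]

lemma tendsto_one_sub_pow_exp {α : Type*} {l : Filter α} {p : α → ℝ} {n : α → ℕ} {c : ℝ}
    (hp : Tendsto p l (𝓝 0)) (hn : Tendsto (fun a => n a * p a) l (𝓝 c)) :
    Tendsto (fun a => (1 - p a) ^ n a) l (𝓝 (Real.exp (-c))) := by
  have hlow : Tendsto (fun a => Real.exp (-(n a * p a / (1 - p a)))) l (𝓝 (Real.exp (-c))) := by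
    have h := (hn.div (tendsto_const_nhds.sub hp) (by norm_num : (1 : ℝ) - 0 ≠ 0)).neg
    simp only [sub_zero, div_one] at h
    exact (Real.continuous_exp.tendsto _).comp h
  have hup : Tendsto (fun a => Real.exp (-(n a * p a))) l (𝓝 (Real.exp (-c))) :=
    (Real.continuous_exp.tendsto _).comp hn.neg
  have hev : ∀ᶠ a in l, p a < 1 := hp.eventually (eventually_lt_nhds zero_lt_one)
  refine tendsto_of_tendsto_of_tendsto_of_le_of_le' hlow hup ?_ ?_
  · filter_upwards [hev] with a ha
    calc Real.exp (-(n a * p a / (1 - p a))) = Real.exp (-(p a / (1 - p a))) ^ n a := by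
          rw [← Real.exp_nat_mul]; congr 1; ring
      _ ≤ _ := pow_le_pow_left₀ (Real.exp_pos _).le (exp_neg_div_one_sub_le ha) _
  · filter_upwards [hev] with a ha
    calc (1 - p a) ^ n a ≤ Real.exp (-p a) ^ n a :=
          pow_le_pow_left₀ (by linarith) (Real.one_sub_le_exp_neg _) _
      _ = _ := by rw [← Real.exp_nat_mul]; congr 1; ring

/-- The rate `φ_i(y) exp(-∑_{j ∈ V_i} φ_j(y))` at which users at `i` are served. -/
noncomputable def fluidRate (y : V → ℝ) (i : V) : ℝ :=
  phi G y i * Real.exp (-∑ j ∈ nbhd G i, phi G y j)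

/-- Binomial laws with `p → 0` and `w p → φ` become Poisson: the weights at 1 and 0 tend to `φ
exp(-φ)` and `exp(-φ)`. Only the products `w p` need converge, so coordinates with `y j = 0` are
allowed. -/
lemma tendsto_serviceProb {α : Type*} {l : Filter α} {m : α → ℕ} {w : α → V → ℕ} {y : V → ℝ}
    (hm : Tendsto m l atTop) (hw : ∀ i, Tendsto (fun a => (w a i : ℝ) / m a) l (𝓝 (y i)))
    (hy : ∀ i, 0 < ∑ j ∈ nbhd G i, y j) (i : V) :
    Tendsto (fun a => serviceProb G i (w a)) l (𝓝 (fluidRate G y i)) := by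
  have hm' : Tendsto (fun a => (m a : ℝ)) l atTop := tendsto_natCast_atTop_atTop.comp hm
  have hsum : ∀ j, Tendsto (fun a => (∑ k ∈ nbhd G j, (w a k : ℝ)) / m a) l
      (𝓝 (∑ k ∈ nbhd G j, y k)) := fun j => by
    simp only [Finset.sum_div]
    exact tendsto_finsetSum _ fun k _ => hw k
  have hpos : ∀ᶠ a in l, (m a : ℝ) ≠ 0 := hm'.eventually_ne_atTop 0
  have hp : ∀ j, Tendsto (fun a => attemptProb G (w a) j) l (𝓝 0) := fun j => by
    have h := hm'.inv_tendsto_atTop.div (hsum j) (hy j).ne'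
    rw [zero_div] at h
    refine h.congr' ?_
    filter_upwards [hpos] with a ha
    simp only [attemptProb, Pi.div_apply, Pi.inv_apply]
    field_simp
  have hwp : ∀ j, Tendsto (fun a => (w a j : ℝ) * attemptProb G (w a) j) l (𝓝 (phi G y j)) :=
    fun j => by
    refine ((hw j).div (hsum j) (hy j).ne').congr' ?_
    filter_upwards [hpos] with a ha
    simp only [attemptProb, Pi.div_apply]
    field_simp
  -- The exponent in the weight at 1 is the truncated `w - 1`; squeezing between `w p - p` and `w p`
  -- covers `w = 0` as well.
  have hwp' : Tendsto (fun a => ((w a i - 1 : ℕ) : ℝ) * attemptProb G (w a) i) l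
      (𝓝 (phi G y i)) := by
    have h := (hwp i).sub (hp i)
    rw [sub_zero] at h
    refine tendsto_of_tendsto_of_tendsto_of_le_of_le h (hwp i) (fun a => ?_) (fun a => ?_)
    · have h1 : (w a i : ℝ) ≤ ((w a i - 1 : ℕ) : ℝ) + 1 := by norm_cast; omega
      have := mul_le_mul_of_nonneg_right h1 (attemptProb_nonneg G (w a) i)
      simp only
      linarith
    · exact mul_le_mul_of_nonneg_right (Nat.cast_le.2 (Nat.sub_le _ _)) (attemptProb_nonneg G (w a) i)
  have hfin : fluidRate G y i = phi G y i * Real.exp (-phi G y i) *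
      ∏ j ∈ (nbhd G i).erase i, Real.exp (-phi G y j) := by
    rw [fluidRate, mul_assoc, Finset.mul_prod_erase (nbhd G i) (fun j => Real.exp (-phi G y j))
      (Finset.mem_insert_self _ _), ← Real.exp_sum, Finset.sum_neg_distrib]
  rw [hfin]
  refine Tendsto.mul ?_ (tendsto_finsetProd _ fun j _ => ?_)
  · refine ((hwp i).mul (tendsto_one_sub_pow_exp (hp i) hwp')).congr fun a => ?_
    simp [binomialWeight]
  · refine (tendsto_one_sub_pow_exp (hp j) (hwp j)).congr fun a => ?_
    simp [binomialWeight]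

lemma exists_serviceProb_close {y : V → ℝ} (hy : ∀ i, 0 < ∑ j ∈ nbhd G i, y j) {ε : ℝ}
    (hε : 0 < ε) : ∃ η > 0, ∃ M : ℕ, ∀ (m : ℕ) (w : V → ℕ), M ≤ m →
      (∀ i, |(w i : ℝ) / m - y i| ≤ η) → ∀ i, |serviceProb G i w - fluidRate G y i| ≤ ε := by
  -- The filter of all pairs with `m → ∞` and `w / m → y`: its basis converts the limit into a bound
  -- uniform over `m` and `w`.
  let l : Filter (ℕ × (V → ℕ)) :=
    comap Prod.fst atTop ⊓ comap (fun a i => (a.2 i : ℝ) / a.1) (𝓝 y)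
  have hm : Tendsto Prod.fst l atTop := tendsto_comap.mono_left inf_le_left
  have hw : Tendsto (fun (a : ℕ × (V → ℕ)) i => (a.2 i : ℝ) / a.1) l (𝓝 y) :=
    tendsto_comap.mono_left inf_le_right
  have h : ∀ᶠ a in l, ∀ i, |serviceProb G i a.2 - fluidRate G y i| ≤ ε := by
    refine eventually_all.2 fun i => ?_
    have := tendsto_serviceProb G hm (tendsto_pi_nhds.1 hw) hy i
    filter_upwards [Metric.tendsto_nhds.1 this ε hε] with a ha
    rw [Real.dist_eq] at ha
    exact ha.le
  have hb : l.HasBasis (fun q : ℕ × ℝ => True ∧ 0 < q.2) _ :=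
    (atTop_basis.comap Prod.fst).inf (Metric.nhds_basis_closedBall.comap _)
  obtain ⟨⟨M, η⟩, ⟨-, hη⟩, hs⟩ := hb.eventually_iff.1 h
  refine ⟨η, hη, M, fun m w hm hw => @hs (m, w) ⟨hm, ?_⟩⟩
  simp only [Set.mem_preimage, Metric.mem_closedBall]
  exact (dist_pi_le_iff (le_of_lt hη)).2 fun i => by rw [Real.dist_eq]; exact hw i

end

/-! ### Consequences of closeness in the Skorokhod metric. -/

section

variable {V : Type*} [Fintype V]

lemma exists_skorokhodDist_lt (T : ℕ) {ε : ℝ} (hε : 0 < ε) :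
    ∃ δ > 0, ∀ f g : CadlagPath V, dist f g < δ → skorokhodDist ((T : ℝ≥0) + 1) f g < ε := by
  -- One term of the series is at most the whole distance, and `D ↦ D / (1 + D)` is increasing.
  refine ⟨(1 / 2 : ℝ) ^ (T + 1) * (ε / (1 + ε)), by positivity, fun f g h => ?_⟩
  have h1 : skorokhodTerm f g T ≤ dist f g :=
    (skorokhodTerm_summable f g).le_tsum T fun _ _ => skorokhodTerm_nonneg f g _
  have h2 := h1.trans_lt h
  have hD := skorokhodDist_nonneg ((T : ℝ≥0) + 1) f g
  unfold skorokhodTerm at h2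
  have h3 := lt_of_mul_lt_mul_left h2 (by positivity)
  rw [div_lt_div_iff₀ (by positivity) (by positivity)] at h3
  nlinarith

lemma exists_timeChange {T : ℝ≥0} {f g : CadlagPath V} {ε : ℝ} (hε : 0 < ε)
    (h : skorokhodDist T f g < ε) :
    ∃ e : TimeChange T, ∀ t : Set.Icc (0 : ℝ≥0) T,
      dist (e t : ℝ≥0) (t : ℝ≥0) ≤ ε ∧ ∀ i, |f (e t : ℝ≥0) i - g (t : ℝ≥0) i| ≤ ε := by
  have h1 : skorokhodEDist T f g < ENNReal.ofReal ε :=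
    (ENNReal.lt_ofReal_iff_toReal_lt (skorokhodEDist_ne_top T f g)).2 h
  obtain ⟨e, he⟩ := iInf_lt_iff.1 h1
  refine ⟨e, fun t => ?_⟩
  have h2 := (le_iSup (fun t : Set.Icc (0 : ℝ≥0) T =>
    ENNReal.ofReal (dist (e t : ℝ≥0) (t : ℝ≥0) + l1Dist (f (e t : ℝ≥0)) (g (t : ℝ≥0)))) t).trans_lt he
  rw [ENNReal.ofReal_lt_ofReal_iff hε] at h2
  have h3 := l1Dist_nonneg (f (e t : ℝ≥0)) (g (t : ℝ≥0))
  have h4 := dist_nonneg (x := (e t : ℝ≥0)) (y := (t : ℝ≥0))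
  refine ⟨by linarith, fun i => ?_⟩
  have h5 : |f (e t : ℝ≥0) i - g (t : ℝ≥0) i| ≤ l1Dist (f (e t : ℝ≥0)) (g (t : ℝ≥0)) :=
    Finset.single_le_sum (f := fun i => |f (e t : ℝ≥0) i - g (t : ℝ≥0) i|)
      (fun _ _ => abs_nonneg _) (Finset.mem_univ i)
  linarith

end

/-! ### Deterministic analysis of nearly fluid paths and their limits. -/

section

variable {V : Type*} [Fintype V] [DecidableEq V] (G : SimpleGraph V) [DecidableRel G.Adj]

/-- The sequence `w` follows the drift `λ_i - serviceProb` up to an error `b` until time `n`. -/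
def FollowsDrift (lam : V → ℝ) (w : ℕ → V → ℕ) (n : ℕ) (b : ℝ) : Prop :=
  ∀ i, ∀ k ≤ n, |(w k i : ℝ) - w 0 i - lam i * k + ∑ l ∈ Finset.range k, serviceProb G i (w l)| ≤ b

/-- The scaled paths that follow the drift up to the relative error `1 / (j + 1)` until time `j`. -/
def nearlyFluidPaths (lam : V → ℝ) (j : ℕ) : Set (CadlagPath V) :=
  {f | ∃ (m : ℕ) (w : ℕ → V → ℕ), f = scaledPath m w ∧ j < m ∧
    FollowsDrift G lam w (j * m) (m / (j + 1))}

variable {G} {lam : V → ℝ}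

lemma FollowsDrift.abs_sub_le {w : ℕ → V → ℕ} {n : ℕ} {b : ℝ} (h : FollowsDrift G lam w n b)
    (i : V) {k l : ℕ} (hkl : k ≤ l) (hl : l ≤ n) :
    |(w l i : ℝ) - w k i - lam i * (l - k) + ∑ r ∈ Finset.Ico k l, serviceProb G i (w r)|
      ≤ 2 * b := by
  have h1 := h i l hl
  have h2 := h i k (hkl.trans hl)
  rw [Finset.sum_Ico_eq_sub _ hkl]
  rw [abs_le] at *
  constructor <;> linarith [h1.1, h1.2, h2.1, h2.2]

/-- Service probabilities lie in `[0, 1]`, so the drift lies in `[λ_i - 1, λ_i]`; the error `b`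
enters at both ends. -/
lemma FollowsDrift.lipschitz {w : ℕ → V → ℕ} {n : ℕ} {b : ℝ} (h : FollowsDrift G lam w n b)
    {i : V} (hi : 0 ≤ lam i) {k l : ℕ} (hkl : k ≤ l) (hl : l ≤ n) :
    |(w l i : ℝ) - w k i| ≤ (lam i + 1) * (l - k) + 2 * b := by
  have h1 := h.abs_sub_le i hkl hl
  have h2 : 0 ≤ ∑ r ∈ Finset.Ico k l, serviceProb G i (w r) :=
    Finset.sum_nonneg fun r _ => serviceProb_nonneg G i _
  have h3 : ∑ r ∈ Finset.Ico k l, serviceProb G i (w r) ≤ l - k := by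
    refine (Finset.sum_le_card_nsmul _ _ 1 fun r _ => serviceProb_le_one G i _).trans ?_
    simp [Nat.cast_sub hkl]
  have h4 : (0 : ℝ) ≤ l - k := by simpa using hkl
  have h5 : 0 ≤ lam i * (l - k) := mul_nonneg hi h4
  rw [abs_le] at *
  constructor <;> nlinarith [h1.1, h1.2]

/-- `⌊m t⌋ / m` approximates `t`. -/
lemma floor_mul_div_le {m : ℕ} (hm : 0 < m) (t : ℝ≥0) :
    (⌊(m : ℝ≥0) * t⌋₊ : ℝ) / m ≤ t ∧ (t : ℝ) - 1 / m < (⌊(m : ℝ≥0) * t⌋₊ : ℝ) / m := by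
  have hm' : (0 : ℝ) < m := by exact_mod_cast hm
  have h1 : ((⌊(m : ℝ≥0) * t⌋₊ : ℝ≥0) : ℝ) ≤ ((m : ℝ≥0) * t : ℝ≥0) :=
    NNReal.coe_le_coe.2 (Nat.floor_le zero_le)
  have h2 : (((m : ℝ≥0) * t : ℝ≥0) : ℝ) < ((⌊(m : ℝ≥0) * t⌋₊ + 1 : ℝ≥0) : ℝ) :=
    NNReal.coe_lt_coe.2 (Nat.lt_floor_add_one _)
  push_cast at h1 h2
  constructor
  · rw [div_le_iff₀ hm']; linarith
  · rw [sub_lt_iff_lt_add, ← add_div, lt_div_iff₀ hm']; linarith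

lemma FollowsDrift.scaledPath_lipschitz {w : ℕ → V → ℕ} {m n : ℕ} {b : ℝ}
    (h : FollowsDrift G lam w n (b * m)) (hm : 0 < m) {i : V} (hi : 0 ≤ lam i) {s t : ℝ≥0}
    (hst : s ≤ t) (ht : (m : ℝ≥0) * t ≤ n) :
    |scaledPath m w t i - scaledPath m w s i| ≤ (lam i + 1) * (t - s + 1 / m) + 2 * b := by
  have hm' : (0 : ℝ) < m := by exact_mod_cast hm
  have hfl : ⌊(m : ℝ≥0) * s⌋₊ ≤ ⌊(m : ℝ≥0) * t⌋₊ := Nat.floor_mono (by gcongr)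
  have h1 := h.lipschitz hi hfl (Nat.floor_le_of_le ht)
  have hs := floor_mul_div_le hm s
  have ht := floor_mul_div_le hm t
  simp only [scaledPath]
  rw [← sub_div, abs_div, abs_of_pos hm', div_le_iff₀ hm']
  refine h1.trans ?_
  have h2 : ((⌊(m : ℝ≥0) * t⌋₊ : ℝ) - ⌊(m : ℝ≥0) * s⌋₊) ≤ (t - s + 1 / m) * m := by
    rw [← div_le_iff₀ hm', sub_div]
    linarith [hs.2, ht.1]
  have h3 := mul_le_mul_of_nonneg_left h2 (by linarith : 0 ≤ lam i + 1)
  linarith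

/-- A Skorokhod limit of nearly fluid paths is approximated uniformly on compact intervals. -/
lemma exists_followsDrift_close (hlam : ∀ i, 0 ≤ lam i) {z : CadlagPath V}
    (hz : ∀ j, z ∈ closure (nearlyFluidPaths G lam j)) (T M : ℕ) {ε : ℝ} (hε : 0 < ε) :
    ∃ (m : ℕ) (w : ℕ → V → ℕ), M ≤ m ∧ 0 < m ∧ 1 / (m : ℝ) ≤ ε ∧
      FollowsDrift G lam w ((T + 1) * m) (ε * m) ∧
      ∀ t : ℝ≥0, t ≤ T + 1 → ∀ i, |scaledPath m w t i - z t i| ≤ ε := by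
  obtain ⟨L, hL⟩ : ∃ L : ℝ, ∀ i, lam i + 1 ≤ L :=
    ⟨∑ i, (lam i + 1), fun i => Finset.single_le_sum (f := fun i => lam i + 1)
      (fun i _ => by linarith [hlam i]) (Finset.mem_univ i)⟩
  -- Error budget: `2 L ε'` for the time shift and for rounding to the grid, `2 ε'` for the drift
  -- error, `ε'` for the distance after the time change.
  obtain ⟨ε', hε', hε1, hε2⟩ : ∃ ε' > 0, ε' ≤ ε ∧ (L * 2 + 3) * ε' ≤ ε := by
    refine ⟨ε / (|L| * 2 + 3), by positivity, div_le_self hε.le (by linarith [abs_nonneg L]), ?_⟩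
    rw [mul_div_assoc', div_le_iff₀ (by positivity), mul_comm]
    have := le_abs_self L
    gcongr
  obtain ⟨J, hJ⟩ := exists_nat_one_div_lt hε'
  obtain ⟨δ, hδ, hd⟩ := exists_skorokhodDist_lt (V := V) T hε'
  -- `J` makes the relative error at most `ε'`, `M` makes `m > j` large enough, and `T + 1` extends
  -- the controlled horizon to the required interval.
  set j := max J (max M (T + 1)) with hj
  obtain ⟨f, ⟨m, w, rfl, hm, hw⟩, hf⟩ := Metric.mem_closure_iff.1 (hz j) δ hδ
  have hm0 : 0 < m := by omega
  have hm' : (0 : ℝ) < m := by exact_mod_cast hm0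
  have hb : (m : ℝ) / (j + 1) ≤ ε' * m := by
    rw [div_eq_mul_one_div, mul_comm]
    refine mul_le_mul_of_nonneg_right (le_trans ?_ hJ.le) hm'.le
    have : (J : ℝ) ≤ j := Nat.cast_le.2 (le_max_left _ _)
    gcongr
  have hmε : 1 / (m : ℝ) ≤ ε' := by
    refine le_trans ?_ hJ.le
    have : (J : ℝ) + 1 ≤ m := by norm_cast; omega
    gcongr
  have hw' : FollowsDrift G lam w ((T + 1) * m) (ε' * m) := fun i k hk =>
    (hw i k (hk.trans (Nat.mul_le_mul_right m (by omega)))).trans hb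
  refine ⟨m, w, by omega, hm0, hmε.trans hε1, fun i k hk => (hw' i k hk).trans (by gcongr),
    fun t ht i => ?_⟩
  rw [dist_comm] at hf
  obtain ⟨e, he⟩ := exists_timeChange hε' (hd _ _ hf)
  obtain ⟨h1, h2⟩ := he ⟨t, zero_le, ht⟩
  set u := e ⟨t, zero_le, ht⟩ with hu
  simp only at h1 h2
  have hmul : ∀ v : ℝ≥0, v ≤ T + 1 → (m : ℝ≥0) * v ≤ ((T + 1) * m : ℕ) := fun v hv => by
    push_cast
    rw [mul_comm]
    gcongr
  -- The time change moves `t` by at most `ε'`; undoing it costs little by near-Lipschitz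
  -- continuity, whence uniform closeness.
  have hlip : |scaledPath m w t i - scaledPath m w u i| ≤ L * (ε' + ε') + 2 * ε' := by
    rw [NNReal.dist_eq, abs_le] at h1
    have hLi : lam i + 1 ≤ L := hL i
    have hi := hlam i
    have hL0 : 0 ≤ L := by linarith
    rcases le_total t (u : ℝ≥0) with htu | htu
    · rw [abs_sub_comm]
      refine (hw'.scaledPath_lipschitz hm0 hi htu (hmul _ u.2.2)).trans ?_
      have : (0 : ℝ) ≤ u - t := sub_nonneg.2 (NNReal.coe_le_coe.2 htu)
      gcongr
      linarith [h1.2]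
    · refine (hw'.scaledPath_lipschitz hm0 hi htu (hmul _ ht)).trans ?_
      have : (0 : ℝ) ≤ t - u := sub_nonneg.2 (NNReal.coe_le_coe.2 htu)
      gcongr
      linarith [h1.1]
  have := abs_sub_le (scaledPath m w t i) (scaledPath m w u i) (z t i)
  have h3 := h2 i
  linarith

lemma lipschitz_of_mem_closure (hlam : ∀ i, 0 ≤ lam i) {z : CadlagPath V}
    (hz : ∀ j, z ∈ closure (nearlyFluidPaths G lam j)) (i : V) {s t : ℝ≥0} (hst : s ≤ t) :
    |z t i - z s i| ≤ (lam i + 1) * (t - s) := by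
  refine le_of_forall_pos_le_add fun κ hκ => ?_
  have hi := hlam i
  obtain ⟨T, hT⟩ := exists_nat_ge t
  -- `λ_i + 5` collects `λ_i + 1` from rounding, 2 from the drift error and 2 from the approximation
  -- at the two endpoints.
  obtain ⟨m, w, -, hm, hmε, hw, hc⟩ := exists_followsDrift_close hlam hz T 0
    (ε := κ / (lam i + 5)) (by positivity)
  have htT : t ≤ T + 1 := hT.trans (by simp)
  have h1 := hw.scaledPath_lipschitz hm hi hst (by push_cast; rw [mul_comm]; gcongr)
  have h2 := hc t htT i
  have h3 := hc s (hst.trans htT) i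
  have h4 : (lam i + 1) * (1 / m) ≤ (lam i + 1) * (κ / (lam i + 5)) := by gcongr
  have h5 : (lam i + 5) * (κ / (lam i + 5)) = κ := by field_simp
  rw [abs_le] at *
  constructor <;> linarith [h1.1, h1.2, h2.1, h2.2, h3.1, h3.2]

/-- Near a time at which all neighbourhood sums are positive, the increments of the limit are
close to the increments predicted by the drift at that time. -/
lemma exists_increment_close (hlam : ∀ i, 0 ≤ lam i) {z : CadlagPath V}
    (hz : ∀ j, z ∈ closure (nearlyFluidPaths G lam j)) {t₀ : ℝ≥0}
    (h0 : ∀ i, 0 < ∑ j ∈ nbhd G i, z t₀ j) {ε : ℝ} (hε : 0 < ε) :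
    ∃ δ > 0, ∀ s t : ℝ≥0, s ≤ t → (t₀ : ℝ) - δ < s → (t : ℝ) < t₀ + δ → ∀ i,
      |z t i - z s i - (t - s) * (lam i - fluidRate G (z t₀) i)| ≤ ε * (t - s) := by
  obtain ⟨η, hη, M, hM⟩ := exists_serviceProb_close G h0 hε
  obtain ⟨L, hL0, hL⟩ : ∃ L : ℝ, 0 < L ∧ ∀ i, lam i + 1 ≤ L :=
    ⟨1 + ∑ i, (lam i + 1), by
      have := Finset.sum_nonneg fun i (_ : i ∈ Finset.univ) => (by linarith [hlam i] : 0 ≤ lam i + 1)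
      linarith, fun i => (Finset.single_le_sum (f := fun i => lam i + 1)
      (fun i _ => by linarith [hlam i]) (Finset.mem_univ i)).trans (by linarith)⟩
  have hcont : ∀ u : ℝ≥0, |(u : ℝ) - t₀| ≤ η / (2 * L) → ∀ i, |z u i - z t₀ i| ≤ η / 2 := by
    intro u hu i
    have hb : (lam i + 1) * |(u : ℝ) - t₀| ≤ η / 2 := by
      calc (lam i + 1) * |(u : ℝ) - t₀| ≤ L * (η / (2 * L)) :=
            mul_le_mul (hL i) hu (abs_nonneg _) hL0.le
        _ = η / 2 := by field_simp
    rcases le_total t₀ u with h | h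
    · rw [abs_of_nonneg (sub_nonneg.2 (NNReal.coe_le_coe.2 h))] at hb
      exact (lipschitz_of_mem_closure hlam hz i h).trans hb
    · rw [abs_sub_comm, abs_of_nonneg (sub_nonneg.2 (NNReal.coe_le_coe.2 h))] at hb
      rw [abs_sub_comm]
      exact (lipschitz_of_mem_closure hlam hz i h).trans hb
  -- Half of the window of `hcont`: the first grid time may precede `s` by up to `1 / m ≤ δ`.
  set δ := η / (2 * L) / 2 with hδ
  have hδ0 : 0 < δ := by positivity
  -- `δ` is fixed before `κ`, which absorbs the approximation errors for given `s` and `t`.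
  refine ⟨δ, hδ0, fun s t hst hs ht i => le_of_forall_pos_le_add fun κ hκ => ?_⟩
  obtain ⟨T, hT⟩ := exists_nat_ge t
  have htT : t ≤ T + 1 := hT.trans (by simp)
  set g := fluidRate G (z t₀) i with hg
  -- In the last bound, 4 covers the two endpoints and twice the drift error; `|lam i - g|` and `ε`
  -- come from replacing the grid increment by `t - s`. With `ε' ≤ η / 2`, the approximant stays
  -- within `η` of `z t₀`.
  obtain ⟨ε', hε', hε1, hε2, hε3⟩ : ∃ ε' > 0, ε' ≤ η / 2 ∧ ε' ≤ δ ∧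
      (4 + |lam i - g| + ε) * ε' ≤ κ := by
    refine ⟨min (min (η / 2) δ) (κ / (4 + |lam i - g| + ε)), by positivity,
      (min_le_left _ _).trans (min_le_left _ _), (min_le_left _ _).trans (min_le_right _ _), ?_⟩
    calc _ ≤ (4 + |lam i - g| + ε) * (κ / (4 + |lam i - g| + ε)) := by gcongr; exact min_le_right _ _
      _ = κ := by field_simp
  obtain ⟨m, w, hMm, hm, hmε, hw, hc⟩ := exists_followsDrift_close hlam hz T M hε'
  have hm' : (0 : ℝ) < m := by exact_mod_cast hm
  have hfl : ⌊(m : ℝ≥0) * s⌋₊ ≤ ⌊(m : ℝ≥0) * t⌋₊ := Nat.floor_mono (by gcongr)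
  have hflT : ⌊(m : ℝ≥0) * t⌋₊ ≤ (T + 1) * m :=
    Nat.floor_le_of_le (by push_cast; rw [mul_comm]; gcongr)
  have h1 := hw.abs_sub_le i hfl hflT
  have hct := hc t htT i
  have hcs := hc s (hst.trans htT) i
  have hbs := floor_mul_div_le hm s
  have hbt := floor_mul_div_le hm t
  simp only [scaledPath] at hct hcs
  set a := ⌊(m : ℝ≥0) * s⌋₊ with ha
  set b := ⌊(m : ℝ≥0) * t⌋₊ with hb
  have hrate : ∀ r ∈ Finset.Ico a b, |serviceProb G i (w r) - g| ≤ ε := by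
    intro r hr
    rw [Finset.mem_Ico] at hr
    refine hM m (w r) hMm (fun k => ?_) i
    have hrm : ⌊(m : ℝ≥0) * (r / m)⌋₊ = r := by
      rw [mul_div_cancel₀ _ (by exact_mod_cast hm.ne'), Nat.floor_natCast]
    have hra : (a : ℝ) / m ≤ r / m := by gcongr; exact hr.1
    have hrb : (r : ℝ) / m ≤ b / m := by gcongr; exact hr.2.le
    have hrt : ((r / m : ℝ≥0)) ≤ t := by
      rw [← NNReal.coe_le_coe]; push_cast; linarith [hbt.1]
    have h2 := hc (r / m) (hrt.trans htT) k
    simp only [scaledPath, hrm] at h2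
    have h3 := hcont (r / m) (by
      push_cast
      rw [abs_le]
      constructor <;> linarith [hbs.2, hbt.1]) k
    have := abs_sub_le ((w r k : ℝ) / m) (z (r / m) k) (z t₀ k)
    linarith
  have hsum : |∑ r ∈ Finset.Ico a b, serviceProb G i (w r) - (b - a) * g| ≤ ε * (b - a) := by
    have hcard : ((b : ℝ) - a) = (Finset.Ico a b).card := by simp [Nat.cast_sub hfl]
    have : ∑ r ∈ Finset.Ico a b, serviceProb G i (w r) - (b - a) * g =
        ∑ r ∈ Finset.Ico a b, (serviceProb G i (w r) - g) := by
      rw [Finset.sum_sub_distrib, Finset.sum_const, hcard, nsmul_eq_mul]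
    rw [this]
    refine (Finset.abs_sum_le_sum_abs _ _).trans ?_
    refine (Finset.sum_le_card_nsmul _ _ ε hrate).trans ?_
    rw [hcard, nsmul_eq_mul, mul_comm]
  have hinc : |((w b i : ℝ) / m - w a i / m) - (b / m - a / m) * (lam i - g)| ≤
      ε * (b / m - a / m) + 2 * ε' := by
    have h4 : |((w b i : ℝ) - w a i) - (b - a) * (lam i - g)| ≤ ε * (b - a) + 2 * (ε' * m) := by
      rw [abs_le] at *
      constructor <;> linarith [h1.1, h1.2, hsum.1, hsum.2]
    have h5 : ((w b i : ℝ) / m - w a i / m) - (b / m - a / m) * (lam i - g) =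
        (((w b i : ℝ) - w a i) - (b - a) * (lam i - g)) / m := by ring
    have h6 : ε * ((b : ℝ) / m - a / m) + 2 * ε' = (ε * (b - a) + 2 * (ε' * m)) / m := by
      field_simp
    rw [h5, h6, abs_div, abs_of_pos hm']
    gcongr
  have hd : |((b : ℝ) / m - a / m) - (t - s)| ≤ ε' := by
    rw [abs_le]
    constructor <;> linarith [hbs.1, hbs.2, hbt.1, hbt.2]
  have hd2 : |(((b : ℝ) / m - a / m) - (t - s)) * (lam i - g)| ≤ ε' * |lam i - g| := by
    rw [abs_mul]; gcongr
  have hd3 : ε * ((b : ℝ) / m - a / m) ≤ ε * (t - s + ε') := by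
    gcongr
    rw [abs_le] at hd
    linarith [hd.2]
  rw [abs_le] at *
  constructor <;> linarith [hinc.1, hinc.2, hd2.1, hd2.2, hct.1, hct.2, hcs.1, hcs.2]

/-- The increment estimate with one endpoint at `t₀` is the little-o form of the derivative within
`[0, ∞)`. For `t₀ > 0` that half-line is a neighbourhood, so the derivative is two-sided. -/
theorem satisfiesFluidEquation_of_mem_closure (hlam : ∀ i, 0 ≤ lam i) {z : CadlagPath V}
    (hz : ∀ j, z ∈ closure (nearlyFluidPaths G lam j)) : SatisfiesFluidEquation G lam z := by
  intro t₀ h0 i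
  have key : HasDerivWithinAt (fun s : ℝ => z s.toNNReal i)
      (lam i - phi G (z t₀) i * Real.exp (-∑ j ∈ nbhd G i, phi G (z t₀) j)) (Set.Ici 0) t₀ := by
    rw [hasDerivWithinAt_iff_isLittleO, Asymptotics.isLittleO_iff]
    intro ε hε
    obtain ⟨δ, hδ, h⟩ := exists_increment_close hlam hz h0 hε
    filter_upwards [self_mem_nhdsWithin,
      mem_nhdsWithin_of_mem_nhds (Ioo_mem_nhds (sub_lt_self (t₀ : ℝ) hδ) (lt_add_of_pos_right _ hδ))]
      with u hu0 hu
    have hu0' : (u.toNNReal : ℝ) = u := Real.coe_toNNReal u hu0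
    simp only [Real.toNNReal_coe, smul_eq_mul, Real.norm_eq_abs]
    rcases le_total t₀ u.toNNReal with hle | hle
    · have h1 := h t₀ u.toNNReal hle (by linarith) (by rw [hu0']; exact hu.2) i
      rw [hu0', fluidRate] at h1
      rwa [abs_of_nonneg (a := u - t₀) (by rw [← hu0']; exact sub_nonneg.2 (NNReal.coe_le_coe.2 hle))]
    · have h1 := h u.toNNReal t₀ hle (by rw [hu0']; exact hu.1) (by linarith) i
      rw [hu0', fluidRate] at h1
      rw [abs_sub_comm u, abs_of_nonneg (a := (t₀ : ℝ) - u) (by rw [← hu0']; exact sub_nonneg.2 (NNReal.coe_le_coe.2 hle)),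
        ← abs_neg]
      refine le_trans (le_of_eq ?_) h1
      congr 1
      ring
  refine ⟨fun ht => key.hasDerivAt (Ici_mem_nhds (NNReal.coe_pos.2 ht)), ?_⟩
  rintro rfl
  simpa using key

end

/-! ### Exponential bounds for martingales with bounded increments -/

section Martingale

variable {Ω : Type*} {m0 : MeasurableSpace Ω} {μ : Measure Ω}

/-- `ξ` is a sequence of martingale differences, bounded by `1`, with respect to `F`. -/
structure IsMartingaleDiff (μ : Measure Ω) (F : ℕ → MeasurableSpace Ω) (ξ : ℕ → Ω → ℝ) : Prop where
  mono : Monotone F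
  le : ∀ n, F n ≤ m0
  measurable : ∀ n, Measurable[F (n + 1)] (ξ n)
  abs_le_one : ∀ n ω, |ξ n ω| ≤ 1
  condExp_eq_zero : ∀ n, μ[ξ n | F n] =ᵐ[μ] 0

namespace IsMartingaleDiff

variable {F : ℕ → MeasurableSpace Ω} {ξ : ℕ → Ω → ℝ}

lemma neg (h : IsMartingaleDiff μ F ξ) : IsMartingaleDiff μ F (fun n => -ξ n) where
  mono := h.mono
  le := h.le
  measurable n := (h.measurable n).neg
  abs_le_one n ω := by simpa using h.abs_le_one n ω
  condExp_eq_zero n := by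
    filter_upwards [condExp_neg (μ := μ) (ξ n) (F n), h.condExp_eq_zero n] with ω h1 h2
    rw [h1, Pi.neg_apply, h2]; simp

lemma measurable_sum (h : IsMartingaleDiff μ F ξ) (n : ℕ) :
    Measurable[F n] (fun ω => ∑ l ∈ Finset.range n, ξ l ω) :=
  Finset.measurable_fun_sum _ fun l hl =>
    (h.measurable l).mono (h.mono (Nat.succ_le_of_lt (Finset.mem_range.1 hl))) le_rfl

lemma abs_sum_le (h : IsMartingaleDiff μ F ξ) (n : ℕ) (ω : Ω) :
    |∑ l ∈ Finset.range n, ξ l ω| ≤ n := by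
  refine (Finset.abs_sum_le_sum_abs _ _).trans ?_
  refine (Finset.sum_le_card_nsmul _ _ 1 fun l _ => h.abs_le_one l ω).trans ?_
  simp

lemma measurable_exp (h : IsMartingaleDiff μ F ξ) (θ : ℝ) (n : ℕ) :
    Measurable[F n] (fun ω => Real.exp (θ * ∑ l ∈ Finset.range n, ξ l ω)) :=
  Real.measurable_exp.comp ((h.measurable_sum n).const_mul θ)

lemma norm_exp_le (h : IsMartingaleDiff μ F ξ) (θ : ℝ) (n : ℕ) (ω : Ω) :
    ‖Real.exp (θ * ∑ l ∈ Finset.range n, ξ l ω)‖ ≤ Real.exp (|θ| * n) := by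
  rw [Real.norm_eq_abs, Real.abs_exp, Real.exp_le_exp]
  refine (le_abs_self _).trans ?_
  rw [abs_mul]
  exact mul_le_mul_of_nonneg_left (h.abs_sum_le n ω) (abs_nonneg _)

variable [IsProbabilityMeasure μ]

lemma integrable_exp (h : IsMartingaleDiff μ F ξ) (θ : ℝ) (n : ℕ) :
    Integrable (fun ω => Real.exp (θ * ∑ l ∈ Finset.range n, ξ l ω)) μ :=
  Integrable.of_bound ((h.measurable_exp θ n).mono (h.le n) le_rfl).aestronglyMeasurable
    _ (Eventually.of_forall (h.norm_exp_le θ n))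

lemma integrable (h : IsMartingaleDiff μ F ξ) (n : ℕ) : Integrable (ξ n) μ :=
  Integrable.of_bound ((h.measurable n).mono (h.le _) le_rfl).aestronglyMeasurable 1
    (Eventually.of_forall (h.abs_le_one n))

/-- The exponential is bounded and known at time `n`, so it can be pulled out of the conditional
expectation of `ξ n`. -/
lemma integral_exp_mul_eq_zero (h : IsMartingaleDiff μ F ξ) (θ : ℝ) (n : ℕ) :
    ∫ ω, Real.exp (θ * ∑ l ∈ Finset.range n, ξ l ω) * ξ n ω ∂μ = 0 := by
  have h1 := condExp_stronglyMeasurable_mul_of_bound (h.le n)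
    (h.measurable_exp θ n).stronglyMeasurable (h.integrable n) _
    (Eventually.of_forall (h.norm_exp_le θ n))
  have h2 := integral_condExp (μ := μ) (h.le n)
    (f := (fun ω => Real.exp (θ * ∑ l ∈ Finset.range n, ξ l ω)) * ξ n)
  simp only [Pi.mul_apply] at h2
  rw [← h2, integral_congr_ae (g := fun _ => (0 : ℝ)), integral_zero]
  filter_upwards [h1, h.condExp_eq_zero n] with ω h3 h4
  rw [h3, Pi.mul_apply, h4]
  simp

/-- As `exp y ≤ 1 + y + y ^ 2` for `|y| ≤ 1` and the linear term integrates to zero, each step costs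
a factor at most `1 + θ ^ 2 ≤ exp (θ ^ 2)`. -/
lemma integral_exp_le (h : IsMartingaleDiff μ F ξ) {θ : ℝ} (hθ : |θ| ≤ 1) (n : ℕ) :
    ∫ ω, Real.exp (θ * ∑ l ∈ Finset.range n, ξ l ω) ∂μ ≤ Real.exp (n * θ ^ 2) := by
  induction n with
  | zero => simp
  | succ n ih =>
    have hprod : Integrable
        (fun ω => Real.exp (θ * ∑ l ∈ Finset.range n, ξ l ω) * ξ n ω) μ :=
      (h.integrable n).bdd_mul ((h.integrable_exp θ n).aestronglyMeasurable)
        (Eventually.of_forall (h.norm_exp_le θ n))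
    have hle : ∀ ω, Real.exp (θ * ∑ l ∈ Finset.range (n + 1), ξ l ω) ≤
        (1 + θ ^ 2) * Real.exp (θ * ∑ l ∈ Finset.range n, ξ l ω) +
          θ * (Real.exp (θ * ∑ l ∈ Finset.range n, ξ l ω) * ξ n ω) := by
      intro ω
      have hx : |θ * ξ n ω| ≤ 1 := by
        rw [abs_mul]
        exact mul_le_one₀ hθ (abs_nonneg _) (h.abs_le_one n ω)
      have h1 := (abs_le.1 (Real.abs_exp_sub_one_sub_id_le hx)).2
      have h2 : (θ * ξ n ω) ^ 2 ≤ θ ^ 2 := by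
        rw [mul_pow]
        have : ξ n ω ^ 2 ≤ 1 := by
          rw [← sq_abs]; exact pow_le_one₀ (abs_nonneg _) (h.abs_le_one n ω)
        nlinarith [sq_nonneg θ]
      rw [Finset.sum_range_succ, mul_add, Real.exp_add]
      have h3 := mul_le_mul_of_nonneg_left
        (show Real.exp (θ * ξ n ω) ≤ 1 + θ ^ 2 + θ * ξ n ω by linarith)
        (Real.exp_pos (θ * ∑ l ∈ Finset.range n, ξ l ω)).le
      linarith
    calc ∫ ω, Real.exp (θ * ∑ l ∈ Finset.range (n + 1), ξ l ω) ∂μ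
        ≤ ∫ ω, ((1 + θ ^ 2) * Real.exp (θ * ∑ l ∈ Finset.range n, ξ l ω) +
          θ * (Real.exp (θ * ∑ l ∈ Finset.range n, ξ l ω) * ξ n ω)) ∂μ :=
          integral_mono (h.integrable_exp θ (n + 1))
            (((h.integrable_exp θ n).const_mul _).add (hprod.const_mul _)) hle
      _ = (1 + θ ^ 2) * ∫ ω, Real.exp (θ * ∑ l ∈ Finset.range n, ξ l ω) ∂μ := by
          rw [integral_add ((h.integrable_exp θ n).const_mul _) (hprod.const_mul _),
            integral_const_mul, integral_const_mul, h.integral_exp_mul_eq_zero, mul_zero, add_zero]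
      _ ≤ Real.exp (θ ^ 2) * Real.exp (n * θ ^ 2) := by
          have := Real.add_one_le_exp (θ ^ 2)
          exact mul_le_mul (by linarith) ih (integral_nonneg fun ω => (Real.exp_pos _).le)
            (Real.exp_pos _).le
      _ = Real.exp ((n + 1 : ℕ) * θ ^ 2) := by
          rw [← Real.exp_add]; congr 1; push_cast; ring

lemma measure_ge_le (h : IsMartingaleDiff μ F ξ) {θ : ℝ} (hθ0 : 0 ≤ θ) (hθ : θ ≤ 1) (n : ℕ)
    (a : ℝ) : μ.real {ω | a ≤ ∑ l ∈ Finset.range n, ξ l ω} ≤ Real.exp (-θ * a + n * θ ^ 2) := by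
  refine (measure_ge_le_exp_mul_mgf a hθ0 (h.integrable_exp θ n)).trans ?_
  rw [Real.exp_add]
  exact mul_le_mul_of_nonneg_left (h.integral_exp_le (by rwa [abs_of_nonneg hθ0]) n)
    (Real.exp_pos _).le

lemma measure_abs_ge_le (h : IsMartingaleDiff μ F ξ) {θ : ℝ} (hθ0 : 0 ≤ θ) (hθ : θ ≤ 1) (n : ℕ)
    (a : ℝ) :
    μ.real {ω | a ≤ |∑ l ∈ Finset.range n, ξ l ω|} ≤ 2 * Real.exp (-θ * a + n * θ ^ 2) := by
  have h1 := h.measure_ge_le hθ0 hθ n a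
  have h2 := h.neg.measure_ge_le hθ0 hθ n a
  simp only [Pi.neg_apply, Finset.sum_neg_distrib] at h2
  have h3 : {ω | a ≤ |∑ l ∈ Finset.range n, ξ l ω|} ⊆
      {ω | a ≤ ∑ l ∈ Finset.range n, ξ l ω} ∪ {ω | a ≤ -∑ l ∈ Finset.range n, ξ l ω} :=
    fun ω (hω : a ≤ |_|) => le_abs.1 hω
  have h4 := (measureReal_mono (μ := μ) h3).trans (measureReal_union_le _ _)
  linarith

/-- The maximum of the partial sums up to time `j m` exceeds `m / (2 (j + 1))` with a probability
that decays exponentially in `m`. -/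
lemma measure_exists_abs_ge_le (h : IsMartingaleDiff μ F ξ) (j m : ℕ) :
    μ.real {ω | ∃ n ≤ j * m, (m : ℝ) / (2 * (j + 1)) ≤ |∑ l ∈ Finset.range n, ξ l ω|} ≤
      2 * (j * m + 1) * Real.exp (-(1 / (16 * (j + 1) ^ 3) * m)) := by
  have hset : {ω | ∃ n ≤ j * m, (m : ℝ) / (2 * (j + 1)) ≤ |∑ l ∈ Finset.range n, ξ l ω|} =
      ⋃ n ∈ Finset.range (j * m + 1),
        {ω | (m : ℝ) / (2 * (j + 1)) ≤ |∑ l ∈ Finset.range n, ξ l ω|} := by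
    ext ω
    simp
  rw [hset]
  refine (measureReal_biUnion_finset_le _ _).trans ?_
  have hj : (1 : ℝ) ≤ j + 1 := by simp
  -- The minimiser of `-θ a + (j + 1) m θ ^ 2` for `a = m / (2 (j + 1))`. A union bound over times
  -- suffices, since its factor `j m + 1` is only linear.
  set θ : ℝ := 1 / (4 * (j + 1) ^ 2) with hθ
  have hθ0 : 0 ≤ θ := by positivity
  have hθ1 : θ ≤ 1 := by
    rw [hθ, div_le_one (by positivity)]
    nlinarith
  refine (Finset.sum_le_card_nsmul _ _ (2 * Real.exp (-(1 / (16 * (j + 1) ^ 3) * m)))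
    fun n hn => ?_).trans ?_
  · refine (h.measure_abs_ge_le hθ0 hθ1 n _).trans ?_
    have hn' : (n : ℝ) ≤ (j + 1) * m := by
      have : n ≤ j * m := Nat.lt_succ_iff.1 (Finset.mem_range.1 hn)
      have : (n : ℝ) ≤ j * m := by exact_mod_cast this
      have : (0 : ℝ) ≤ m := by positivity
      linarith
    have h1 : n * θ ^ 2 ≤ (j + 1) * m * θ ^ 2 := by gcongr
    have h2 : (j + 1) * m * θ ^ 2 = 1 / (16 * ((j : ℝ) + 1) ^ 3) * m := by
      rw [hθ]; field_simp; ring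
    have h3 : θ * ((m : ℝ) / (2 * (j + 1))) = 2 * (1 / (16 * ((j : ℝ) + 1) ^ 3) * m) := by
      rw [hθ]; field_simp; ring
    gcongr
    rw [neg_mul, h3]
    linarith
  · rw [Finset.card_range, nsmul_eq_mul]
    push_cast
    linarith

end IsMartingaleDiff

end Martingale

/-! ### Summability over initial conditions -/

/-- Any finite set of states lies in a box, over which the sum factorises into partial geometric
series. -/
lemma summable_exp_neg_mul_sum {V : Type*} [Fintype V] {c : ℝ} (hc : 0 < c) :
    Summable fun x : V → ℕ => Real.exp (-(c * (∑ i, x i : ℕ))) := by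
  classical
  have hs : Summable fun k : ℕ => Real.exp (-c) ^ k :=
    summable_geometric_of_lt_one (Real.exp_pos _).le (Real.exp_lt_one_iff.2 (by linarith))
  have heq : ∀ x : V → ℕ, Real.exp (-(c * (∑ i, x i : ℕ))) = ∏ i, Real.exp (-c) ^ x i := by
    intro x
    rw [Finset.prod_pow_eq_pow_sum, ← Real.exp_nat_mul]
    congr 1
    ring
  simp only [heq]
  refine summable_of_sum_le (c := ∏ _i : V, ∑' k : ℕ, Real.exp (-c) ^ k)
    (fun x => Finset.prod_nonneg fun i _ => pow_nonneg (Real.exp_pos _).le _) fun u => ?_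
  calc ∑ x ∈ u, ∏ i, Real.exp (-c) ^ x i
      ≤ ∑ x ∈ Fintype.piFinset fun i => u.image fun x => x i, ∏ i, Real.exp (-c) ^ x i :=
        Finset.sum_le_sum_of_subset_of_nonneg
          (fun x hx => Fintype.mem_piFinset.2 fun i => Finset.mem_image_of_mem _ hx)
          fun x _ _ => Finset.prod_nonneg fun i _ => pow_nonneg (Real.exp_pos _).le _
    _ = ∏ i, ∑ k ∈ u.image fun x => x i, Real.exp (-c) ^ k :=
        (Finset.prod_univ_sum _ fun _ k => Real.exp (-c) ^ k).symm
    _ ≤ _ := Finset.prod_le_prod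
        (fun i _ => Finset.sum_nonneg fun k _ => pow_nonneg (Real.exp_pos _).le _)
        fun i _ => hs.sum_le_tsum _ fun k _ => pow_nonneg (Real.exp_pos _).le _

/-- Half of the exponential decay absorbs the linear factor. -/
lemma summable_linear_mul_exp_neg {V : Type*} [Fintype V] {a c : ℝ} (ha : 0 ≤ a) (hc : 0 < c) :
    Summable fun x : V → ℕ =>
      2 * (a * (∑ i, x i : ℕ) + 1) * Real.exp (-(c * (∑ i, x i : ℕ))) := by
  refine Summable.of_nonneg_of_le (fun x => by positivity) (fun x => ?_)
    ((summable_exp_neg_mul_sum (V := V) (half_pos hc)).mul_left (2 * (2 * a / c + 1)))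
  generalize (∑ i, x i) = m
  have h1 : a * (m : ℝ) + 1 ≤ (2 * a / c + 1) * Real.exp (c / 2 * m) := by
    have h2 := Real.add_one_le_exp (c / 2 * m)
    calc a * (m : ℝ) + 1 ≤ (2 * a / c + 1) * (c / 2 * m + 1) := by
          have h3 : (2 * a / c + 1) * (c / 2 * m + 1) = a * m + 1 + (2 * a / c + c / 2 * m) := by
            field_simp; ring
          rw [h3]
          have : 0 ≤ 2 * a / c + c / 2 * m := by positivity
          linarith
      _ ≤ _ := by gcongr
  have h4 : Real.exp (c / 2 * m) * Real.exp (-(c * m)) = Real.exp (-(c / 2 * m)) := by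
    rw [← Real.exp_add]; congr 1; ring
  calc 2 * (a * (m : ℝ) + 1) * Real.exp (-(c * m))
      ≤ 2 * ((2 * a / c + 1) * Real.exp (c / 2 * m)) * Real.exp (-(c * m)) := by gcongr
    _ = 2 * (2 * a / c + 1) * (Real.exp (c / 2 * m) * Real.exp (-(c * m))) := by ring
    _ = _ := by rw [h4]

/-! ### A uniform consequence of the law of large numbers -/

/-- Beyond `n₀` the error is small relative to `k ≤ (j + 1) m`; the finitely many earlier errors are
bounded, hence negligible for large `m`. -/
lemma eventually_forall_abs_sub_le {S : ℕ → ℝ} {a : ℝ}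
    (h : Tendsto (fun n : ℕ => S n / n) atTop (𝓝 a)) (j : ℕ) {ε : ℝ} (hε : 0 < ε) :
    ∀ᶠ m : ℕ in atTop, ∀ k ≤ j * m, |S k - a * k| ≤ ε * m := by
  obtain ⟨n₀, hn₀⟩ := Metric.tendsto_atTop.1 h (ε / (j + 1)) (by positivity)
  obtain ⟨M, hM⟩ := exists_nat_ge ((∑ k ∈ Finset.range (n₀ + 1), |S k - a * k|) / ε)
  filter_upwards [eventually_ge_atTop M] with m hm k hk
  rcases le_or_gt k n₀ with h1 | h1
  · have h2 := Finset.single_le_sum (f := fun k : ℕ => |S k - a * k|)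
      (fun _ _ => abs_nonneg _) (Finset.mem_range.2 (Nat.lt_succ_of_le h1))
    rw [div_le_iff₀ hε] at hM
    have h3 : (M : ℝ) * ε ≤ m * ε := by gcongr
    linarith
  · have hk0 : (0 : ℝ) < k := by exact_mod_cast (by omega : 0 < k)
    have h2 := (hn₀ k h1.le).le
    rw [Real.dist_eq, show S k / k - a = (S k - a * k) / k by field_simp, abs_div,
      abs_of_pos hk0, div_le_iff₀ hk0] at h2
    refine h2.trans ?_
    have h3 : (k : ℝ) ≤ (j + 1) * m := by
      have : (k : ℝ) ≤ j * m := by exact_mod_cast hk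
      have : (0 : ℝ) ≤ m := by positivity
      linarith
    calc ε / (j + 1) * k ≤ ε / (j + 1) * ((j + 1) * m) := by gcongr
      _ = ε * m := by field_simp

/-! ### Conditional service probabilities -/

section

variable {V : Type*} [Fintype V] [DecidableEq V] (G : SimpleGraph V) [DecidableRel G.Adj]

/-- The attempts `k` for which a user at `i` is served. -/
def servedSet (i : V) : Set (V → ℕ) := {k | k i = 1 ∧ ∀ j ∈ (nbhd G i).erase i, k j = 0}

/-- The weight at `k` of the joint distribution of the attempts, given the numbers of users `w`. -/
noncomputable def attemptWeight (w k : V → ℕ) : ℝ :=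
  ∏ i, binomialWeight (w i) (attemptProb G w i) (k i)

lemma attemptWeight_nonneg (w k : V → ℕ) : 0 ≤ attemptWeight G w k :=
  Finset.prod_nonneg fun i _ =>
    binomialWeight_nonneg (attemptProb_nonneg G w i) (attemptProb_le_one G w i) _ _

/-- The nonzero weights sit in a finite box, over which the sum factorises; vertices outside `V_i`
contribute total mass 1. -/
lemma tsum_attemptWeight_servedSet (i : V) (w : V → ℕ) :
    ∑' k : servedSet G i, ENNReal.ofReal (attemptWeight G w k) =
      ENNReal.ofReal (serviceProb G i w) := by
  classical
  let t : V → Finset ℕ := fun l =>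
    if l = i then {1} else if l ∈ nbhd G i then {0} else Finset.range (w l + 1)
  have ht1 : t i = {1} := if_pos rfl
  have ht0 : ∀ l ∈ (nbhd G i).erase i, t l = {0} := fun l hl => by
    rw [Finset.mem_erase] at hl
    simp [t, hl.1, hl.2]
  have hts : ∀ l ∉ nbhd G i, t l = Finset.range (w l + 1) := fun l hl => by
    have : l ≠ i := fun h => hl (h ▸ Finset.mem_insert_self _ _)
    simp [t, hl, this]
  have hmem : ∀ k ∈ Fintype.piFinset t, k ∈ servedSet G i := fun k hk => by
    rw [Fintype.mem_piFinset] at hk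
    refine ⟨by simpa [ht1] using hk i, fun j hj => ?_⟩
    have := hk j
    rwa [ht0 j hj, Finset.mem_singleton] at this
  rw [tsum_subtype (servedSet G i) fun k => ENNReal.ofReal (attemptWeight G w k),
    tsum_eq_sum (s := Fintype.piFinset t),
    Finset.sum_congr rfl fun k hk => Set.indicator_of_mem (hmem k hk) _,
    ← ENNReal.ofReal_sum_of_nonneg fun k _ => attemptWeight_nonneg G w k]
  · congr 1
    simp only [attemptWeight]
    rw [← Finset.prod_univ_sum t fun l k => binomialWeight (w l) (attemptProb G w l) k,
      ← Finset.prod_subset (Finset.subset_univ (nbhd G i)) fun l _ hl => by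
        rw [hts l hl, sum_binomialWeight],
      ← Finset.mul_prod_erase (nbhd G i) _ (Finset.mem_insert_self _ _), ht1,
      Finset.sum_singleton, serviceProb]
    congr 1
    exact Finset.prod_congr rfl fun l hl => by rw [ht0 l hl, Finset.sum_singleton]
  · intro k hk
    by_cases hks : k ∈ servedSet G i
    · rw [Set.indicator_of_mem hks]
      rw [Fintype.mem_piFinset] at hk
      push Not at hk
      obtain ⟨l, hl⟩ := hk
      have hlV : l ∉ nbhd G i := by
        intro hlV
        by_cases hli : l = i
        · subst hli
          exact hl (by rw [ht1, hks.1]; simp)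
        · have := Finset.mem_erase.2 ⟨hli, hlV⟩
          exact hl (by rw [ht0 l this, hks.2 l this]; simp)
      rw [hts l hlV, Finset.mem_range, not_lt] at hl
      rw [attemptWeight, Finset.prod_eq_zero (Finset.mem_univ l) (binomialWeight_eq_zero hl _),
        ENNReal.ofReal_zero]
    · exact Set.indicator_of_notMem hks _

variable {Ω : Type*} [mΩ : MeasurableSpace Ω] {μ : Measure Ω} {lam : V → ℝ}
  {A : ℕ → Ω → V → ℕ} {N : (V → ℕ) → ℕ → Ω → V → ℕ}

omit [Fintype V] [DecidableEq V] mΩ in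
lemma history_mono (A N : ℕ → Ω → V → ℕ) : Monotone (history A N) := fun _ _ h =>
  sup_le_sup (biSup_mono fun _ hm => hm.trans_le h) (biSup_mono fun _ hm => hm.trans_le h)

omit [Fintype V] [DecidableEq V] in
lemma history_le {A N : ℕ → Ω → V → ℕ} (hA : ∀ n, Measurable (A n)) (hN : ∀ n, Measurable (N n))
    (n : ℕ) : history A N n ≤ mΩ :=
  sup_le (iSup₂_le fun m _ => (hA m).comap_le) (iSup₂_le fun m _ => (hN m).comap_le)

omit [Fintype V] [DecidableEq V] mΩ in
lemma measurable_arrivals_history (A N : ℕ → Ω → V → ℕ) (n : ℕ) :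
    Measurable[history A N (n + 1)] (A n) :=
  Measurable.of_comap_le (le_sup_of_le_left
    (le_iSup₂ (f := fun m (_ : m < n + 1) => MeasurableSpace.comap (A m) inferInstance)
      n n.lt_succ_self))

omit [Fintype V] [DecidableEq V] mΩ in
lemma measurable_attempts_history (A N : ℕ → Ω → V → ℕ) (n : ℕ) :
    Measurable[history A N (n + 1)] (N n) :=
  Measurable.of_comap_le (le_sup_of_le_right
    (le_iSup₂ (f := fun m (_ : m < n + 1) => MeasurableSpace.comap (N m) inferInstance)
      n n.lt_succ_self))

omit mΩ in
lemma measurable_workload (A N : ℕ → Ω → V → ℕ) (x : V → ℕ) (n : ℕ) :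
    Measurable[history A N n] (workload G A N x n) := by
  induction n with
  | zero => exact @measurable_const _ _ _ (history A N 0) x
  | succ n ih =>
    have h1 := ih.mono (history_mono A N n.le_succ) le_rfl
    have h2 := measurable_arrivals_history A N n
    have h3 := measurable_attempts_history A N n
    exact (Measurable.of_discrete (f := fun (p : (V → ℕ) × (V → ℕ) × (V → ℕ)) (i : V) =>
      p.1 i + p.2.1 i - (if p.2.2 i = 1 ∧ ∀ j ∈ (nbhd G i).erase i, p.2.2 j = 0 then 1 else 0))).comp
      (h1.prodMk (h2.prodMk h3))

/-- `1` if a user at `i` is served at time `n`, and `0` otherwise. -/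
noncomputable def served (N : ℕ → Ω → V → ℕ) (i : V) (n : ℕ) (ω : Ω) : ℝ :=
  (servedSet G i).indicator 1 (N n ω)

variable {G}

lemma IsModel.measurable_served (h : IsModel G μ lam A N) (x : V → ℕ) (n : ℕ) (i : V) :
    Measurable (served G (N x) i n) :=
  (Measurable.of_discrete (f := (servedSet G i).indicator (1 : (V → ℕ) → ℝ))).comp
    (h.measurable_attempts x n)

omit mΩ in
lemma served_mem_Icc (N : ℕ → Ω → V → ℕ) (i : V) (n : ℕ) (ω : Ω) :
    served G N i n ω ∈ Set.Icc (0 : ℝ) 1 := by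
  unfold served
  by_cases h : N n ω ∈ servedSet G i <;> simp [h]

/-- The strong law is applied to each coordinate separately, so dependence between coordinates does
not matter. -/
lemma IsModel.ae_tendsto_arrivals (h : IsModel G μ lam A N) :
    ∀ᵐ ω ∂μ, ∀ i, Tendsto (fun n : ℕ => (∑ l ∈ Finset.range n, (A l ω i : ℝ)) / n) atTop
      (𝓝 (lam i)) := by
  rw [ae_all_iff]
  intro i
  have hm : Measurable fun a : V → ℕ => (a i : ℝ) := Measurable.of_discrete
  have := strong_law_ae_real (μ := μ) (fun n ω => (A n ω i : ℝ)) (h.arrivals_integrable 0 i)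
    (fun m n hmn => (h.arrivals_indep.indepFun hmn).comp hm hm)
    (fun n => (h.arrivals_identDistrib n).comp hm)
  rwa [h.arrivals_mean 0 i] at this

variable [IsProbabilityMeasure μ]

/-- The model gives conditional probabilities of single values `k` only. Integrated over `B`, they
can be summed over the countable set of serving `k` by `lintegral_tsum`. -/
lemma IsModel.measure_inter_servedSet (h : IsModel G μ lam A N) (x : V → ℕ) (n : ℕ) (i : V)
    {B : Set Ω} (hB : MeasurableSet[history A (N x) n] B) :
    μ (N x n ⁻¹' servedSet G i ∩ B) =
      ∫⁻ ω in B, ENNReal.ofReal (serviceProb G i (workload G A (N x) x n ω)) ∂μ := by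
  have hle := history_le h.measurable_arrivals (h.measurable_attempts x) n
  have hB' : MeasurableSet B := hle _ hB
  have hW : Measurable (workload G A (N x) x n) :=
    (measurable_workload G A (N x) x n).mono hle le_rfl
  have hk : ∀ k : V → ℕ, μ (N x n ⁻¹' {k} ∩ B) =
      ∫⁻ ω in B, ENNReal.ofReal (attemptWeight G (workload G A (N x) x n ω) k) ∂μ := by
    intro k
    have hkm : MeasurableSet (N x n ⁻¹' {k}) :=
      h.measurable_attempts x n (measurableSet_singleton k)
    have h1 := setIntegral_condExp (μ := μ) hle
      (f := (N x n ⁻¹' {k}).indicator fun _ => (1 : ℝ)) ((integrable_const 1).indicator hkm) hB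
    rw [setIntegral_indicator hkm, setIntegral_const, smul_eq_mul, mul_one, Set.inter_comm] at h1
    have h2 : ∀ᵐ ω ∂μ.restrict B, (μ[(N x n ⁻¹' {k}).indicator fun _ => (1 : ℝ) |
        history A (N x) n]) ω = attemptWeight G (workload G A (N x) x n ω) k :=
      ae_restrict_of_ae (h.attempts_law x n k)
    rw [← ofReal_measureReal, ← h1, integral_congr_ae h2, ofReal_integral_eq_lintegral_ofReal]
    · exact (integrable_condExp.integrableOn).congr h2
    · exact Eventually.of_forall fun ω => attemptWeight_nonneg G _ _
  have hS : N x n ⁻¹' servedSet G i ∩ B = ⋃ k : servedSet G i, N x n ⁻¹' {(k : V → ℕ)} ∩ B := by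
    ext ω
    simp
  rw [hS, measure_iUnion]
  · simp only [hk]
    rw [← lintegral_tsum]
    · simp only [tsum_attemptWeight_servedSet]
    · exact fun k => (Measurable.of_discrete (f := fun w : V → ℕ =>
        ENNReal.ofReal (attemptWeight G w k)).comp hW).aemeasurable
  · intro k l hkl
    refine Disjoint.mono Set.inter_subset_left Set.inter_subset_left ?_
    exact Disjoint.preimage _ (Set.disjoint_singleton.2 fun h => hkl (Subtype.ext h))
  · exact fun k => (h.measurable_attempts x n (measurableSet_singleton _)).inter hB'

omit mΩ in
lemma measurable_serviceProb (A N : ℕ → Ω → V → ℕ) (x : V → ℕ) (n : ℕ) (i : V) :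
    Measurable[history A N n] (fun ω => serviceProb G i (workload G A N x n ω)) :=
  (Measurable.of_discrete (f := serviceProb G i)).comp (measurable_workload G A N x n)

lemma IsModel.integrable_serviceProb (h : IsModel G μ lam A N) (x : V → ℕ) (n : ℕ) (i : V) :
    Integrable (fun ω => serviceProb G i (workload G A (N x) x n ω)) μ :=
  Integrable.of_bound ((measurable_serviceProb A (N x) x n i).mono
    (history_le h.measurable_arrivals (h.measurable_attempts x) n) le_rfl).aestronglyMeasurable 1 <|
    Eventually.of_forall fun ω => by
      rw [Real.norm_of_nonneg (serviceProb_nonneg G i _)]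
      exact serviceProb_le_one G i _

lemma IsModel.integrable_served (h : IsModel G μ lam A N) (x : V → ℕ) (n : ℕ) (i : V) :
    Integrable (served G (N x) i n) μ :=
  Integrable.of_bound (h.measurable_served x n i).aestronglyMeasurable 1 <|
    Eventually.of_forall fun ω => by
      have := served_mem_Icc (G := G) (N x) i n ω
      rw [Real.norm_of_nonneg this.1]
      exact this.2

lemma IsModel.condExp_served (h : IsModel G μ lam A N) (x : V → ℕ) (n : ℕ) (i : V) :
    μ[served G (N x) i n | history A (N x) n] =ᵐ[μ]
      fun ω => serviceProb G i (workload G A (N x) x n ω) := by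
  have hle := history_le h.measurable_arrivals (h.measurable_attempts x) n
  have hW := measurable_serviceProb (G := G) A (N x) x n i
  have hq := h.integrable_serviceProb x n i
  have hs := h.integrable_served x n i
  refine (ae_eq_condExp_of_forall_setIntegral_eq hle hs (fun B _ _ => hq.integrableOn)
    (fun B hB _ => ?_) hW.aestronglyMeasurable).symm
  have hm : MeasurableSet (N x n ⁻¹' servedSet G i) :=
    h.measurable_attempts x n (Set.to_countable _).measurableSet
  have h1 : served G (N x) i n = (N x n ⁻¹' servedSet G i).indicator fun _ => (1 : ℝ) := by
    ext ω
    by_cases hω : N x n ω ∈ servedSet G i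
    · rw [Set.indicator_of_mem (Set.mem_preimage.2 hω)]; simp [served, hω]
    · rw [Set.indicator_of_notMem (mt Set.mem_preimage.1 hω)]; simp [served, hω]
  rw [h1, setIntegral_indicator hm, setIntegral_const, smul_eq_mul, mul_one, Set.inter_comm,
    measureReal_def, h.measure_inter_servedSet x n i hB,
    integral_eq_lintegral_of_nonneg_ae (Eventually.of_forall fun ω => serviceProb_nonneg G i _)
      (hW.mono hle le_rfl).aestronglyMeasurable]

lemma IsModel.isMartingaleDiff (h : IsModel G μ lam A N) (x : V → ℕ) (i : V) :
    IsMartingaleDiff μ (history A (N x)) fun n ω =>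
      served G (N x) i n ω - serviceProb G i (workload G A (N x) x n ω) where
  mono := history_mono A (N x)
  le := history_le h.measurable_arrivals (h.measurable_attempts x)
  measurable n := by
    refine Measurable.sub ?_ ?_
    · exact (Measurable.of_discrete (f := (servedSet G i).indicator (1 : (V → ℕ) → ℝ))).comp
        (measurable_attempts_history A (N x) n)
    · exact (Measurable.of_discrete (f := serviceProb G i)).comp
        ((measurable_workload G A (N x) x n).mono (history_mono A (N x) n.le_succ) le_rfl)
  abs_le_one n ω := by
    have h1 := served_mem_Icc (G := G) (N x) i n ω
    have h2 := serviceProb_nonneg G i (workload G A (N x) x n ω)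
    have h3 := serviceProb_le_one G i (workload G A (N x) x n ω)
    rw [abs_le]
    constructor <;> linarith [h1.1, h1.2]
  condExp_eq_zero n := by
    have hle := history_le h.measurable_arrivals (h.measurable_attempts x) n
    have hW := measurable_serviceProb (G := G) A (N x) x n i
    have hq := h.integrable_serviceProb x n i
    have hs := h.integrable_served x n i
    have h1 := condExp_of_stronglyMeasurable (μ := μ) hle hW.stronglyMeasurable hq
    filter_upwards [condExp_sub (μ := μ) hs hq (history A (N x) n), h.condExp_served x n i]
      with ω h2 h3
    change (μ[served G (N x) i n - fun ω => serviceProb G i (workload G A (N x) x n ω) |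
      history A (N x) n]) ω = 0
    rw [h2, Pi.sub_apply, h3, h1, sub_self]

/-- Almost surely nobody is served at an empty vertex. -/
lemma IsModel.ae_workload_pos_of_served (h : IsModel G μ lam A N) :
    ∀ᵐ ω ∂μ, ∀ x n i, N x n ω ∈ servedSet G i → 0 < workload G A (N x) x n ω i := by
  simp only [ae_all_iff]
  intro x n i
  have hB : MeasurableSet[history A (N x) n] {ω | workload G A (N x) x n ω i = 0} :=
    measurable_workload G A (N x) x n (Set.to_countable {w : V → ℕ | w i = 0}).measurableSet
  -- The service probability vanishes on the event that the vertex is empty.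
  have h1 := h.measure_inter_servedSet x n i hB
  rw [setLIntegral_congr_fun (g := fun _ => 0)
    (history_le h.measurable_arrivals (h.measurable_attempts x) n _ hB)
    (fun ω (hω : _ = 0) => by simp [serviceProb_eq_zero G hω]), lintegral_zero] at h1
  filter_upwards [measure_eq_zero_iff_ae_notMem.1 h1] with ω hω hs
  exact Nat.pos_of_ne_zero fun h0 => hω ⟨hs, h0⟩

omit mΩ in
/-- The balance equation for the numbers of users. -/
lemma workload_eq {A N : ℕ → Ω → V → ℕ} {x : V → ℕ} {ω : Ω}
    (h : ∀ n i, N n ω ∈ servedSet G i → 0 < workload G A N x n ω i) (n : ℕ) (i : V) :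
    (workload G A N x n ω i : ℝ) = x i + ∑ l ∈ Finset.range n, (A l ω i : ℝ) -
      ∑ l ∈ Finset.range n, served G N i l ω := by
  induction n with
  | zero => simp [workload]
  | succ n ih =>
    rw [Finset.sum_range_succ, Finset.sum_range_succ]
    by_cases hs : N n ω ∈ servedSet G i
    · have hpos := h n i hs
      have h1 : workload G A N x (n + 1) ω i = workload G A N x n ω i + A n ω i - 1 := by
        simp only [workload]; exact congrArg _ (if_pos hs)
      rw [h1, Nat.cast_sub (by omega)]
      simp only [served, Set.indicator_of_mem hs, Nat.cast_add, Nat.cast_one, Pi.one_apply]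
      simp only [served] at ih
      linarith
    · have h1 : workload G A N x (n + 1) ω i = workload G A N x n ω i + A n ω i := by
        simp only [workload]; exact congrArg _ (if_neg hs)
      rw [h1]
      simp only [served, Set.indicator_of_notMem hs, Nat.cast_add]
      simp only [served] at ih
      linarith

/-! ### The scaled processes are nearly fluid -/

variable (G) in
/-- The event that the compensated number of services at `i` of the system started at `x` exceeds
`|x| / (2 (j + 1))` before time `j |x|`. -/
def largeDeviationEvent (A : ℕ → Ω → V → ℕ) (N : (V → ℕ) → ℕ → Ω → V → ℕ) (j : ℕ) (i : V)
    (x : V → ℕ) : Set Ω :=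
  {ω | ∃ n ≤ j * ∑ i, x i, ((∑ i, x i : ℕ) : ℝ) / (2 * (j + 1)) ≤ |∑ l ∈ Finset.range n,
    (served G (N x) i l ω - serviceProb G i (workload G A (N x) x l ω))|}

/-- Borel–Cantelli over the initial states, not over the index of the sequence: `|x n|` may grow so
slowly that the bounds are not summable in `n`. -/
lemma IsModel.ae_finite_largeDeviationEvent (h : IsModel G μ lam A N) :
    ∀ᵐ ω ∂μ, ∀ (j : ℕ) (i : V), {x | ω ∈ largeDeviationEvent G A N j i x}.Finite := by
  simp only [ae_all_iff]
  intro j i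
  have hs := summable_linear_mul_exp_neg (V := V) (Nat.cast_nonneg (α := ℝ) j)
    (c := 1 / (16 * ((j : ℝ) + 1) ^ 3)) (by positivity)
  refine ae_finite_setOfPred_mem
    (ne_top_of_le_ne_top hs.tsum_ofReal_ne_top (ENNReal.tsum_le_tsum fun x => ?_))
  rw [← ofReal_measureReal]
  exact ENNReal.ofReal_le_ofReal ((h.isMartingaleDiff x i).measure_exists_abs_ge_le j _)

theorem IsModel.ae_eventually_mem_nearlyFluidPaths (h : IsModel G μ lam A N) {x : ℕ → V → ℕ}
    (hx : Tendsto (fun n => ∑ i, x n i) atTop atTop) :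
    ∀ᵐ ω ∂μ, ∀ j, ∀ᶠ n in atTop, scaledProcess G A N (x n) ω ∈ nearlyFluidPaths G lam j := by
  filter_upwards [h.ae_tendsto_arrivals, h.ae_finite_largeDeviationEvent, h.ae_workload_pos_of_served]
    with ω hA hM hW j
  have hA' : ∀ᶠ m : ℕ in atTop, ∀ i, ∀ k ≤ j * m,
      |∑ l ∈ Finset.range k, (A l ω i : ℝ) - lam i * k| ≤ 1 / (2 * ((j : ℝ) + 1)) * m :=
    eventually_all.2 fun i => eventually_forall_abs_sub_le (hA i) j (by positivity)
  -- Sizes are bounded on a finite set of states, so the sequence eventually leaves it.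
  have hxc : Tendsto x atTop cofinite := by
    intro s hs
    have hs' : sᶜ.Finite := mem_cofinite.1 hs
    obtain ⟨C, hC⟩ := (hs'.image fun y => ∑ i, y i).bddAbove
    rw [mem_map]
    filter_upwards [hx.eventually_gt_atTop C] with n hn
    by_contra hns
    exact absurd (hC ⟨x n, hns, rfl⟩) (not_le.2 hn)
  have hM' : ∀ᶠ n in atTop, ∀ i, ω ∉ largeDeviationEvent G A N j i (x n) :=
    eventually_all.2 fun i => hxc.eventually (hM j i).eventually_cofinite_notMem
  filter_upwards [hx.eventually hA', hM', hx.eventually_gt_atTop j] with n h1 h2 h3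
  refine ⟨∑ i, x n i, _, rfl, h3, fun i k hk => ?_⟩
  have h4 := h1 i k hk
  have h6 := lt_of_not_ge fun h5 => h2 i ⟨k, hk, h5⟩
  rw [Finset.sum_sub_distrib] at h6
  rw [workload_eq (hW (x n)) k i]
  simp only [workload]
  set m : ℝ := ((∑ i, x n i : ℕ) : ℝ) with hm
  -- Half of the allowed error goes to the arrivals, half to the martingale.
  have h7 : m / ((j : ℝ) + 1) = 1 / (2 * (j + 1)) * m + m / (2 * (j + 1)) := by
    field_simp; ring
  rw [h7]
  rw [abs_le] at *
  rw [abs_lt] at h6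
  constructor <;> linarith [h4.1, h4.2, h6.1, h6.2]

end

/-! ### Passage to the limit, path by path and in distribution. -/

lemma MapClusterPt.mem_closure_of_eventually {X : Type*} [TopologicalSpace X] {ι : Type*}
    {l : Filter ι} {u : ι → X} {z : X} {s : Set X} (h : MapClusterPt z l u)
    (hs : ∀ᶠ n in l, u n ∈ s) : z ∈ closure s := by
  refine mem_closure_iff_nhds.2 fun t ht => ?_
  obtain ⟨n, h1, h2⟩ := ((mapClusterPt_iff_frequently.1 h t ht).and_eventually hs).exists
  exact ⟨u n, h1, h2⟩

/-- A limit in distribution of random elements that are almost surely eventually in `s` lies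
almost surely in the closure of `s`. -/
lemma TendstoInDistribution.ae_mem_closure {E Ω Ω' : Type*} [PseudoMetricSpace E]
    [MeasurableSpace E] [BorelSpace E] [MeasurableSpace Ω] {μ : Measure Ω} [IsProbabilityMeasure μ]
    [MeasurableSpace Ω'] {ν : Measure Ω'} [IsProbabilityMeasure ν] {X : ℕ → Ω → E} {z : Ω' → E}
    (h : TendstoInDistribution X atTop z (fun _ => μ) ν) {s : Set E}
    (hs : ∀ᵐ ω ∂μ, ∀ᶠ n in atTop, X n ω ∈ s) : ∀ᵐ ω ∂ν, z ω ∈ closure s := by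
  have hc : MeasurableSet (closure s) := isClosed_closure.measurableSet
  have h1 := ProbabilityMeasure.limsup_measure_closed_le_of_tendsto h.tendsto
    (isClosed_closure (s := s))
  simp only [ProbabilityMeasure.coe_mk] at h1
  -- Dominated convergence; with the portmanteau inequality `h1` it forces the limit law to give
  -- `closure s` full mass.
  have h2 : Tendsto (fun n => μ.map (X n) (closure s)) atTop (𝓝 1) := by
    have h3 : Tendsto (fun n => ∫⁻ ω, (closure s).indicator 1 (X n ω) ∂μ) atTop
        (𝓝 (∫⁻ _, 1 ∂μ)) := by
      refine tendsto_lintegral_of_dominated_convergence' (fun _ => 1)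
        (fun n => (measurable_one.indicator hc).comp_aemeasurable (h.forall_aemeasurable n))
        (fun n => Eventually.of_forall fun ω => Set.indicator_le_self' (fun _ _ => zero_le) _)
        (by simp) ?_
      filter_upwards [hs] with ω hω
      refine tendsto_const_nhds.congr' ?_
      filter_upwards [hω] with n hn
      rw [Set.indicator_of_mem (subset_closure hn), Pi.one_apply]
    simp only [lintegral_one, measure_univ] at h3
    refine h3.congr fun n => ?_
    rw [← lintegral_map' (measurable_one.indicator hc).aemeasurable (h.forall_aemeasurable n),
      lintegral_indicator_one hc]
  rw [h2.limsup_eq, Measure.map_apply_of_aemeasurable h.aemeasurable_limit hc] at h1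
  have h4 : ν (z ⁻¹' closure s) = 1 := le_antisymm prob_le_one h1
  have h5 := (prob_compl_eq_zero_iff₀ (h.aemeasurable_limit.nullMeasurableSet_preimage hc)).2 h4
  exact h5

end SpatialAloha

theorem theorem3 {V : Type*} [Fintype V] [DecidableEq V]
    (G : SimpleGraph V) [DecidableRel G.Adj] (hG : G.Connected)
    {Ω : Type*} [MeasurableSpace Ω] (μ : Measure Ω) [IsProbabilityMeasure μ]
    (lam : V → ℝ) (A : ℕ → Ω → V → ℕ) (N : (V → ℕ) → ℕ → Ω → V → ℕ)
    (hmodel : SpatialAloha.IsModel G μ lam A N)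
    (x : ℕ → V → ℕ) (hx : Tendsto (fun n => ∑ i, x n i) atTop atTop) :
    (∀ᵐ ω ∂μ, ∀ z : SpatialAloha.CadlagPath V,
      SpatialAloha.IsPathwiseFluidLimit
        (fun n => SpatialAloha.scaledProcess G A N (x n) ω) z →
      SpatialAloha.SatisfiesFluidEquation G lam z) ∧
    (∀ (Ω' : Type*) [MeasurableSpace Ω'] (ν : Measure Ω') [IsProbabilityMeasure ν]
      (z : Ω' → SpatialAloha.CadlagPath V),
      SpatialAloha.IsFluidLimitInLaw μ
        (fun n => SpatialAloha.scaledProcess G A N (x n)) ν z →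
      ∀ᵐ ω' ∂ν, SpatialAloha.SatisfiesFluidEquation G lam (z ω')) := by
  have hlam : ∀ i, 0 ≤ lam i := fun i => (hmodel.mean_pos i).le
  have hnear := hmodel.ae_eventually_mem_nearlyFluidPaths hx
  refine ⟨?_, ?_⟩
  · filter_upwards [hnear] with ω hω z hz
    exact SpatialAloha.satisfiesFluidEquation_of_mem_closure hlam fun j =>
      SpatialAloha.MapClusterPt.mem_closure_of_eventually hz (hω j)
  · rintro Ω' _ ν _ z ⟨s, hs, hz⟩
    have h : ∀ j, ∀ᵐ ω' ∂ν, z ω' ∈ closure (SpatialAloha.nearlyFluidPaths G lam j) := fun j =>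
      SpatialAloha.TendstoInDistribution.ae_mem_closure hz
        (hnear.mono fun ω hω => hs.tendsto_atTop.eventually (hω j))
    filter_upwards [ae_all_iff.2 h] with ω' hω'
    exact SpatialAloha.satisfiesFluidEquation_of_mem_closure hlam hω'
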